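/- Let $M$ be a connected three-dimensional smooth manifold and let $F\colon TM\to[0,\infty)$ be a Finsler metric: $F$ is continuous, smooth off the zero section, satisfies $F(tv)=tF(v)$ for $t>0$, and, with $E=\tfrac12F^2$, the Hessian $g_{ij}=\partial^2E/\partial y^i\partial y^j$ is positive definite at every nonzero tangent vector, where $(x^i,y^i)$ are the coordinates on $TM$ induced by local coordinates $(u^i)$ on $M$. Assume that $F$ is not Riemannian, i.e. $E$ is not quadratic on all tangent spaces. On the indicatrix $\partial K_p=F^{-1}(1)\cap T_pM$ put $$\mu=\sqrt{\det g_{ij}}\ \sum_{i=1}^3(-1)^{i-1}\frac{y^i}{F}\,dy^1\wedge\cdots\wedge\widehat{dy^i}\wedge\cdots\wedge dy^3,\qquad \gamma_p(v,w)=v^iw^j\int_{\partial K_p}g_{ij}\,\mu ,$$ where integrals over $\partial K_p$ are taken with its outward orientation relative to $dy^1\wedge dy^2\wedge dy^3$; $\gamma$ is called the averaged Riemannian metric. Let $\nabla$ be a smooth linear connection on $M$ which is compatible with $F$ (its parallel transports along smooth curves preserve $F$) and whose torsion $T$ is totally anti-symmetric, i.e. $(X,Y,Z)\mapsto\gamma(T(X,Y),Z)$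 is a $3$-form. Then $\gamma$ has a Levi-Civita connection $\nabla^*$ (torsion-free, with $\nabla^*\gamma=0$), and for every local coordinate system $(u^i)$ of $M$ the following holds on its domain. Let $\times_\gamma$ be the cross product of $\gamma$ for the orientation in which $(\partial/\partial u^1,\partial/\partial u^2,\partial/\partial u^3)$ is positive, so that $\gamma(\partial/\partial u^1\times_\gamma\partial/\partial u^2,\partial/\partial u^3)=\sqrt{\det\gamma_{ij}}$, and let $\times_{g^*}$ be the corresponding cross product of vertical vectors of $TM$, for $g^*_{ij}=\gamma_{ij}\circ\pi$, where $\pi\colon TM\to M$ is the projection. With $C=\sum_j y^j\,\partial/\partial y^j$ and the Christoffel symbols $\Gamma^{*l}_{ij}$ of $\nabla^*$ put $$V_i=\tfrac12\,\frac{\partial}{\partial y^i}\times_{g^*}C,\qquad X_i^{h^*}=\frac{\partial}{\partial x^i}-y^j\,(\Gamma^{*l}_{ij}\circ\pi)\,\frac{\partial}{\partial y^l},\qquad V=\sum_{i=1}^3(V_iE)\,X_i^{h^*},\qquad \sigma(p)=\sum_{i=1}^3\int_{\partial K_p}(V_iE)^2\,\mu .$$ Then $\sigma(p)>0$ at every point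 $p$ of the domain, and $$\nabla_XY=\nabla^*_XY+\frac f2\,X\times_\gamma Y,\qquad f(p)=\frac1{\sigma(p)}\int_{\partial K_p}VE\,\mu .$$ -/

import Mathlib

open Set MeasureTheory
open scoped Manifold ContDiff Matrix

noncomputable section

namespace Finsler

/-! ### Objects on one tangent space, in linear coordinates `y ∈ ℝ³`

Here `φ : ℝ³ → ℝ` is the restriction of the Finsler function to a tangent space. -/

/-- The coordinate space `ℝ³`. -/
abbrev R3 : Type := EuclideanSpace ℝ (Fin 3)

/-- The standard basis vector `e_i` of `ℝ³`. -/
abbrev basisVec (i : Fin 3) : R3 := EuclideanSpace.single i (1 : ℝ)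

/-- The energy `E = φ² / 2`. -/
def energy (φ : R3 → ℝ) (y : R3) : ℝ := φ y ^ 2 / 2

/-- The components `g_{ij}(y) = ∂²E / ∂y^i ∂y^j` of the Riemann-Finsler metric. -/
def hessian (φ : R3 → ℝ) (y : R3) : Matrix (Fin 3) (Fin 3) ℝ :=
  Matrix.of fun i j =>
    fderiv ℝ (fun z => fderiv ℝ (energy φ) z (basisVec j)) y (basisVec i)

/-- The induced volume form
`μ = √(det g) (y¹ dy²∧dy³ - y² dy¹∧dy³ + y³ dy¹∧dy²) / φ` at `y`, evaluated at `a` and `b`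
(the alternating sum is the determinant with rows `y, a, b`). -/
def inducedVolumeForm (φ : R3 → ℝ) (y a b : R3) : ℝ :=
  √(hessian φ y).det *
    (Matrix.det !![y 0, y 1, y 2; a 0, a 1, a 2; b 0, b 1, b 2] / φ y)

/-- The radial projection `v ↦ v / φ(v)` of `ℝ³ \ {0}` to the indicatrix `∂K = {φ = 1}`. Its
restriction to the Euclidean unit sphere is a diffeomorphism onto `∂K` that respects the outward
orientations. -/
def radialMap (φ : R3 → ℝ) (v : R3) : R3 := (φ v)⁻¹ • v

/-- The integral `∫_{∂K} h μ` of the two-form `h μ` over the indicatrix `∂K = {φ = 1}` with its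
outward orientation: the two-form is pulled back to the unit sphere by the radial projection and
integrated there. The integral over the oriented sphere of a two-form `α` of `ℝ³` is the integral
of `u¹ α(e_2, e_3) + u² α(e_3, e_1) + u³ α(e_1, e_2)` with respect to the surface measure;
`i + 1` and `i + 2` below are taken modulo `3`. -/
def indicatrixIntegral (φ h : R3 → ℝ) : ℝ :=
  ∫ u : Metric.sphere (0 : R3) 1,
    h (radialMap φ u) *
      ∑ i : Fin 3, (u : R3) i *
        inducedVolumeForm φ (radialMap φ u)
          (fderiv ℝ (radialMap φ) u (basisVec (i + 1)))
          (fderiv ℝ (radialMap φ) u (basisVec (i + 2)))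
    ∂(volume : Measure R3).toSphere

/-- The Gram matrix `∫_{∂K} g_{ij} μ` of the averaged inner product. -/
def averagedGram (φ : R3 → ℝ) : Matrix (Fin 3) (Fin 3) ℝ :=
  Matrix.of fun i j => indicatrixIntegral φ fun y => hessian φ y i j

/-- The cross product of `ℝ³` with respect to the inner product with Gram matrix `G` and the
standard orientation, see `cross_spec`. -/
def cross (G : Matrix (Fin 3) (Fin 3) ℝ) (a b : R3) : R3 :=
  WithLp.toLp 2 (√G.det • (G⁻¹ *ᵥ (crossProduct (WithLp.ofLp a) (WithLp.ofLp b))))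

/-- The defining property of the cross product: `G(a ×_G b, w)` is the value at `(a, b, w)` of the
volume form `√(det G) dy¹∧dy²∧dy³` of `G`. -/
theorem cross_spec (G : Matrix (Fin 3) (Fin 3) ℝ) (hG : G.PosDef) (a b w : R3) :
    WithLp.ofLp w ⬝ᵥ (G *ᵥ WithLp.ofLp (cross G a b)) =
      √G.det * Matrix.det !![a 0, a 1, a 2; b 0, b 1, b 2; w 0, w 1, w 2] := by
  have h : IsUnit G.det := hG.det_pos.ne'.isUnit
  simp only [cross, Matrix.mulVec_smul, Matrix.mulVec_mulVec, Matrix.mul_nonsing_inv G h,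
    Matrix.one_mulVec, dotProduct_smul, smul_eq_mul]
  congr 1
  simp [cross_apply, Matrix.det_fin_three, dotProduct, Fin.sum_univ_three]
  ring

/-! ### Objects on a three-dimensional manifold -/

variable {M : Type*} [TopologicalSpace M] [ChartedSpace R3 M]

/-- The coordinates `(v¹, v², v³)` of a tangent vector `v ∈ T_pM` in the chart `e`. -/
def coords (e : OpenPartialHomeomorph M R3) (p : M) (v : TangentSpace (𝓡 3) p) : R3 :=
  mfderiv (𝓡 3) 𝓘(ℝ, R3) e p v

/-- The tangent vector at `p` with coordinates `y` in the chart `e`. -/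
def ofCoords (e : OpenPartialHomeomorph M R3) (p : M) (y : R3) : TangentSpace (𝓡 3) p :=
  (mfderiv (𝓡 3) 𝓘(ℝ, R3) e p).inverse y

/-- The coordinate vector field `∂/∂u^j` of the chart `e` (used on `e.source` only). -/
def coordField (e : OpenPartialHomeomorph M R3) (j : Fin 3) (p : M) : TangentSpace (𝓡 3) p :=
  ofCoords e p (basisVec j)

variable [IsManifold (𝓡 3) ∞ M]

/-- The Finsler function in the induced coordinates `(x, y)` of the tangent manifold. -/
def localF (F : TangentBundle (𝓡 3) M → ℝ) (e : OpenPartialHomeomorph M R3) (x y : R3) : ℝ :=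
  F ⟨e.symm x, ofCoords e (e.symm x) y⟩

/-- `F : TM → [0, ∞)` is a Finsler metric: continuous, smooth off the zero section, positively
homogeneous of degree one, with positive definite Hessians `g_{ij}` at all nonzero vectors. -/
structure IsFinslerMetric (F : TangentBundle (𝓡 3) M → ℝ) : Prop where
  continuous : Continuous F
  nonneg : ∀ v, 0 ≤ F v
  smooth : ContMDiffOn (𝓡 3).tangent 𝓘(ℝ, ℝ) ∞ F {v | v.2 ≠ 0}
  homogeneous : ∀ (p : M) (v : TangentSpace (𝓡 3) p) (t : ℝ), 0 < t → F ⟨p, t • v⟩ = t * F ⟨p, v⟩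
  strongly_convex : ∀ e ∈ IsManifold.maximalAtlas (𝓡 3) ∞ M, ∀ x ∈ e.target, ∀ y : R3, y ≠ 0 →
    (hessian (localF F e x) y).PosDef

/-- The Finsler metric is Riemannian: its energy is quadratic on every tangent space. -/
def IsRiemannian (F : TangentBundle (𝓡 3) M → ℝ) : Prop :=
  ∀ p : M, ∃ Q : QuadraticForm ℝ (TangentSpace (𝓡 3) p), ∀ v : TangentSpace (𝓡 3) p,
    F ⟨p, v⟩ ^ 2 = Q v

/-- The components `γ_{ij} = ∫_{∂K_p} g_{ij} μ` of the averaged metric in the chart `e`, at the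
point with coordinates `x`. -/
def gram (F : TangentBundle (𝓡 3) M → ℝ) (e : OpenPartialHomeomorph M R3) (x : R3) :
    Matrix (Fin 3) (Fin 3) ℝ :=
  averagedGram (localF F e x)

/-- The averaged Riemannian metric `γ_p(v, w) = v^i w^j ∫_{∂K_p} g_{ij} μ`. The value does not
depend on the chart around `p` that is used to compute it; we take the preferred one. -/
def averagedMetric (F : TangentBundle (𝓡 3) M → ℝ) (p : M) (v w : TangentSpace (𝓡 3) p) : ℝ :=
  ∑ i : Fin 3, ∑ j : Fin 3,
    coords (chartAt R3 p) p v i * coords (chartAt R3 p) p w j *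
      gram F (chartAt R3 p) (chartAt R3 p p) i j

/-- The cross product `v ×_γ w` in `T_pM` with respect to the averaged metric and the orientation
for which the coordinate vector fields of the chart `e` form a positive basis. -/
def crossγ (F : TangentBundle (𝓡 3) M → ℝ) (e : OpenPartialHomeomorph M R3) (p : M)
    (v w : TangentSpace (𝓡 3) p) : TangentSpace (𝓡 3) p :=
  ofCoords e p (cross (gram F e (e p)) (coords e p v) (coords e p w))

/-- A linear connection on `M`; `nabla Y p v` is `(∇_v Y)(p)`. -/
abbrev LinearConnection (M : Type*) [TopologicalSpace M] [ChartedSpace R3 M]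
    [IsManifold (𝓡 3) ∞ M] :=
  CovariantDerivative (𝓡 3) R3 (TangentSpace (𝓡 3) : M → Type _)

/-- The connection coefficient `Γ_{ij}^k` in the chart `e`: the `k`-th coordinate of
`∇_{∂/∂u^i} ∂/∂u^j`. -/
def connCoeff (nabla : LinearConnection M) (e : OpenPartialHomeomorph M R3)
    (i j k : Fin 3) (p : M) : ℝ :=
  coords e p (nabla (coordField e j) p (coordField e i p)) k

/-- The vector field `X` along the curve `c : [0, 1] → M` is parallel: in local coordinates
`(X^k)' = - (c^i)' X^j Γ_{ij}^k ∘ c`. The condition at the parameter `t` does not depend on the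
chart around `c t`. -/
def IsParallel (nabla : LinearConnection M) (c : ℝ → M)
    (X : ∀ t : ℝ, TangentSpace (𝓡 3) (c t)) : Prop :=
  ∀ t ∈ Icc (0 : ℝ) 1, ∃ e ∈ IsManifold.maximalAtlas (𝓡 3) ∞ M, c t ∈ e.source ∧
    ∀ k : Fin 3, HasDerivWithinAt (fun s => coords e (c s) (X s) k)
      (-∑ i : Fin 3, ∑ j : Fin 3,
        derivWithin (fun s => e (c s) i) (Icc (0 : ℝ) 1) t * coords e (c t) (X t) j *
          connCoeff nabla e i j k (c t))
      (Icc (0 : ℝ) 1) t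

/-- The parallel transports with respect to `nabla` preserve the Finslerian length of tangent
vectors. -/
def IsCompatible (F : TangentBundle (𝓡 3) M → ℝ) (nabla : LinearConnection M) : Prop :=
  ∀ c : ℝ → M, ContMDiffOn 𝓘(ℝ, ℝ) (𝓡 3) ∞ c (Icc (0 : ℝ) 1) →
    ∀ X : ∀ t : ℝ, TangentSpace (𝓡 3) (c t), IsParallel nabla c X →
      ∀ t ∈ Icc (0 : ℝ) 1, F ⟨c t, X t⟩ = F ⟨c 0, X 0⟩

/-- The lowered torsion tensor `T_♭(u, v, w) = γ(T(u, v), w)` is totally anti-symmetric. -/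
def HasTotallyAntisymmetricTorsion (F : TangentBundle (𝓡 3) M → ℝ)
    (nabla : LinearConnection M) : Prop :=
  ∀ (p : M) (u v w : TangentSpace (𝓡 3) p),
    averagedMetric F p (nabla.torsion p u v) w = -averagedMetric F p (nabla.torsion p v u) w ∧
    averagedMetric F p (nabla.torsion p u v) w = -averagedMetric F p (nabla.torsion p u w) v

/-- A vector field is differentiable at `p`. -/
def VFDiffAt (Y : ∀ q : M, TangentSpace (𝓡 3) q) (p : M) : Prop :=
  MDifferentiableAt (𝓡 3) (𝓡 3).tangent (fun q => (⟨q, Y q⟩ : TangentBundle (𝓡 3) M)) p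

/-- `nabla` is the Levi-Civita connection of the averaged Riemannian metric `γ`: it is torsion-free
and satisfies `v γ(Y, Z) = γ(∇_v Y, Z) + γ(Y, ∇_v Z)`. -/
def IsLeviCivita (F : TangentBundle (𝓡 3) M → ℝ) (nabla : LinearConnection M) : Prop :=
  (∀ p : M, nabla.torsion p = 0) ∧
  ∀ (p : M) (Y Z : ∀ q : M, TangentSpace (𝓡 3) q), VFDiffAt Y p → VFDiffAt Z p →
    MDifferentiableAt (𝓡 3) 𝓘(ℝ, ℝ) (fun q => averagedMetric F q (Y q) (Z q)) p ∧
    ∀ v : TangentSpace (𝓡 3) p,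
      mfderiv (𝓡 3) 𝓘(ℝ, ℝ) (fun q => averagedMetric F q (Y q) (Z q)) p v =
        averagedMetric F p (nabla Y p v) (Z p) + averagedMetric F p (Y p) (nabla Z p v)

/-! ### The explicit function `f`, in the induced coordinates `(x, y)` of a chart `e` -/

/-- The derivative of the energy `E` along the horizontal vector field
`X_i^h = ∂/∂x^i - y^j Γ_{ij}^l ∂/∂y^l` of a linear connection. -/
def horizontalE (F : TangentBundle (𝓡 3) M → ℝ) (nabla : LinearConnection M)
    (e : OpenPartialHomeomorph M R3) (i : Fin 3) (x y : R3) : ℝ :=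
  fderiv ℝ (fun x' => energy (localF F e x') y) x (basisVec i) -
    ∑ j : Fin 3, ∑ l : Fin 3, y j * connCoeff nabla e i j l (e.symm x) *
      fderiv ℝ (energy (localF F e x)) y (basisVec l)

/-- The derivative `V_i E` along the vertical vector field `V_i = ½ ∂/∂y^i ×_{g*} C`, where `C` is
the Liouville vector field and `g*_{ij} = γ_{ij} ∘ π`. -/
def verticalE (F : TangentBundle (𝓡 3) M → ℝ) (e : OpenPartialHomeomorph M R3)
    (i : Fin 3) (x y : R3) : ℝ :=
  fderiv ℝ (energy (localF F e x)) y ((1 / 2 : ℝ) • cross (gram F e x) (basisVec i) y)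

/-- The derivative `V E`, where `V = ∑_i (V_i E) X_i^h`. -/
def derivVE (F : TangentBundle (𝓡 3) M → ℝ) (nabla : LinearConnection M)
    (e : OpenPartialHomeomorph M R3) (x y : R3) : ℝ :=
  ∑ i : Fin 3, verticalE F e i x y * horizontalE F nabla e i x y

/-- `σ(p) = ∑_i ∫_{∂K_p} (V_i E)² μ`. -/
def sigmaFn (F : TangentBundle (𝓡 3) M → ℝ) (e : OpenPartialHomeomorph M R3) (p : M) : ℝ :=
  ∑ i : Fin 3, indicatrixIntegral (localF F e (e p)) fun y => verticalE F e i (e p) y ^ 2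

/-- `f(p) = (1 / σ(p)) ∫_{∂K_p} V E μ`, where `nablaStar` is the Levi-Civita connection. -/
def fFn (F : TangentBundle (𝓡 3) M → ℝ) (nablaStar : LinearConnection M)
    (e : OpenPartialHomeomorph M R3) (p : M) : ℝ :=
  1 / sigmaFn F e p *
    indicatrixIntegral (localF F e (e p)) fun y => derivVE F nablaStar e (e p) y

end Finsler

end

/-!
A connection compatible with `F` identifies the tangent spaces, by its parallel transports,
as normed spaces. Everything built from the norm of a tangent space alone is therefore parallel;
in particular the averaged metric `γ` is (`IsCompatible.averagedMetric_deriv`), and the energy is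
constant along horizontal lifts (`IsCompatible.horizontalE_eq_zero`). Instead of working with
curves, both are deduced from one statement: near a point `x₀` of a chart the norms are
`localF F e x = localF F e x₀ ∘ Q x` for linear isomorphisms `Q x` with `Q x₀ = 1`, whose derivative
at `x₀` is the matrix of connection coefficients (`IsCompatible.exists_local_isometry`). Here `Q x`
is the inverse parallel transport along the segment from `x₀` to `x`, and its derivative is found by
a first order estimate of the solutions of the linear transport equation (`exists_transport`). The
functoriality of `γ` under linear isomorphisms, `IsMinkowski.formOf_averagedGram_comp`, comes from
rewriting the integral over the indicatrix as an integral over the unit ball `K`, for which the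
linear change of variables is available (`IsMinkowski.indicatrixIntegral_comp`).

As `nabla` is metric with totally antisymmetric torsion `T`, subtracting `T / 2` gives a torsion-free
metric connection, which proves the existence of `∇*`. Conversely the difference of `nabla` and any
Levi-Civita connection is totally antisymmetric after lowering an index, so in dimension three it is
`c` times the cross product (`IsCompatible.exists_sub_eq_smul_cross`). Since the horizontal lifts of
`nabla` annihilate `E`, those of `∇*` satisfy `X_i^{h*} E = 2 c V_i E`; hence `∫ V E μ = 2 c σ` and
`f = 2 c` (`fFn_eq`).

It remains to see that `σ ≠ 0` (`sigmaFn_pos`). If `σ(p) = 0`, then all `V_i E` vanish on `T_pM`, so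
`E` is invariant under the rotations of `γ_p` and hence a multiple of `γ_p`
(`IsMinkowski.exists_sq_eq_of_rotation`). As the tangent spaces are locally isometric and `M` is
connected, `F` would be Riemannian (`IsCompatible.isRiemannian_of_quadratic`).
-/

noncomputable section

namespace Finsler

/-! ### Minkowski norms on `ℝ³` -/

/-- A (not necessarily reversible) Minkowski norm: the properties of the restriction of a Finsler
metric to one tangent space, in linear coordinates. Continuity at the origin is not needed. -/
structure IsMinkowski (φ : R3 → ℝ) : Prop where
  nonneg : ∀ y, 0 ≤ φ y
  homog : ∀ (t : ℝ) (y : R3), 0 < t → φ (t • y) = t * φ y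
  smooth : ∀ y ≠ 0, ContDiffAt ℝ ∞ φ y
  posDef : ∀ y ≠ 0, (hessian φ y).PosDef

/-- The bilinear form with matrix `G`, as a plain function; `formOfCLM` is its bundled version. -/
def formOf (G : Matrix (Fin 3) (Fin 3) ℝ) (v w : R3) : ℝ :=
  ∑ i : Fin 3, ∑ j : Fin 3, v i * w j * G i j

theorem formOf_eq_dotProduct (G : Matrix (Fin 3) (Fin 3) ℝ) (v w : R3) :
    formOf G v w = WithLp.ofLp v ⬝ᵥ (G *ᵥ WithLp.ofLp w) := by
  simp [formOf, dotProduct, Matrix.mulVec, Fin.sum_univ_three]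
  ring

theorem formOf_basisVec (G : Matrix (Fin 3) (Fin 3) ℝ) (i j : Fin 3) :
    formOf G (basisVec i) (basisVec j) = G i j := by
  fin_cases i <;> fin_cases j <;> simp [formOf]

theorem eq_sum_basisVec (v : R3) : v = ∑ i, v i • basisVec i := by
  ext k
  fin_cases k <;> simp [Fin.sum_univ_three]

theorem formOf_of_bilinear (L : R3 →L[ℝ] R3 →L[ℝ] ℝ) (v w : R3) :
    formOf (Matrix.of fun i j => L (basisVec i) (basisVec j)) v w = L v w := by
  conv_rhs => rw [eq_sum_basisVec v, eq_sum_basisVec w]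
  simp [formOf, Fin.sum_univ_three]
  ring

/-- `formOf G` as a continuous bilinear map. -/
def formOfCLM (G : Matrix (Fin 3) (Fin 3) ℝ) : R3 →L[ℝ] R3 →L[ℝ] ℝ :=
  ∑ i : Fin 3, ∑ j : Fin 3,
    G i j • (EuclideanSpace.proj (𝕜 := ℝ) i).smulRight (EuclideanSpace.proj (𝕜 := ℝ) j)

theorem formOfCLM_apply (G : Matrix (Fin 3) (Fin 3) ℝ) (v w : R3) :
    formOfCLM G v w = formOf G v w := by
  simp [formOfCLM, formOf, Fin.sum_univ_three]
  ring

theorem formOf_posDef {G : Matrix (Fin 3) (Fin 3) ℝ} (hG : G.PosDef) {v : R3} (hv : v ≠ 0) :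
    0 < formOf G v v := by
  rw [formOf_eq_dotProduct]
  have := hG.dotProduct_mulVec_pos (x := WithLp.ofLp v) (by simpa using hv)
  simpa using this

theorem formOf_symm {G : Matrix (Fin 3) (Fin 3) ℝ} (hG : G.PosDef) (v w : R3) :
    formOf G v w = formOf G w v := by
  have h : ∀ i j, G i j = G j i := fun i j => by simpa using (hG.isHermitian.apply i j).symm
  simp only [formOf, Fin.sum_univ_three, h 1 0, h 2 0, h 2 1]
  ring

theorem posDef_of_formOf {G : Matrix (Fin 3) (Fin 3) ℝ} (hs : ∀ i j, G i j = G j i)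
    (hp : ∀ v : R3, v ≠ 0 → 0 < formOf G v v) : G.PosDef := by
  refine Matrix.PosDef.of_dotProduct_mulVec_pos ?_ fun x hx => ?_
  · ext i j
    simp [hs i j]
  · have := hp (WithLp.toLp 2 x) (by simpa using hx)
    simpa [formOf_eq_dotProduct] using this

/-- The matrix of a linear map in the standard basis. -/
def matOf (A : R3 →L[ℝ] R3) : Matrix (Fin 3) (Fin 3) ℝ :=
  Matrix.of fun i j => A (basisVec j) i

theorem det_matOf (A : R3 →L[ℝ] R3) : (matOf A).det = LinearMap.det (A : R3 →ₗ[ℝ] R3) := by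
  rw [← LinearMap.det_toMatrix (EuclideanSpace.basisFun (Fin 3) ℝ).toBasis]
  congr 1

theorem matrix_eq_of_formOf {G H : Matrix (Fin 3) (Fin 3) ℝ} (A : R3 →L[ℝ] R3)
    (h : ∀ v w, formOf H v w = formOf G (A v) (A w)) : H = (matOf A)ᵀ * G * matOf A := by
  ext i j
  rw [← formOf_basisVec H, h]
  simp [matOf, formOf, Matrix.mul_apply, Fin.sum_univ_three]
  ring

theorem det_of_formOf {G H : Matrix (Fin 3) (Fin 3) ℝ} (A : R3 →L[ℝ] R3)
    (h : ∀ v w, formOf H v w = formOf G (A v) (A w)) :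
    H.det = LinearMap.det (A : R3 →ₗ[ℝ] R3) ^ 2 * G.det := by
  rw [matrix_eq_of_formOf A h, Matrix.det_mul, Matrix.det_mul, Matrix.det_transpose, det_matOf]
  ring

namespace IsMinkowski

variable {φ : R3 → ℝ} (hφ : IsMinkowski φ)
include hφ

theorem map_zero : φ 0 = 0 := by
  have := hφ.homog 2 0 (by norm_num)
  simp at this
  linarith

theorem energy_smooth {y : R3} (hy : y ≠ 0) : ContDiffAt ℝ ∞ (energy φ) y := by
  unfold energy
  exact ((hφ.smooth y hy).pow 2).div_const _

theorem energy_differentiableAt {y : R3} (hy : y ≠ 0) : DifferentiableAt ℝ (energy φ) y :=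
  (hφ.energy_smooth hy).differentiableAt (by simp)

theorem fderiv_energy_smooth {y : R3} (hy : y ≠ 0) :
    ContDiffAt ℝ ∞ (fderiv ℝ (energy φ)) y :=
  (hφ.energy_smooth hy).fderiv_right (by simp)

theorem hessian_eq {y : R3} (hy : y ≠ 0) :
    hessian φ y = Matrix.of fun i j =>
      fderiv ℝ (fderiv ℝ (energy φ)) y (basisVec i) (basisVec j) := by
  ext i j
  have h := (hφ.fderiv_energy_smooth hy).differentiableAt (by simp)
  have := h.hasFDerivAt.clm_apply (hasFDerivAt_const (basisVec j) y)
  simp [hessian, this.fderiv]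

theorem formOf_hessian {y : R3} (hy : y ≠ 0) (v w : R3) :
    formOf (hessian φ y) v w = fderiv ℝ (fderiv ℝ (energy φ)) y v w := by
  rw [hφ.hessian_eq hy, formOf_of_bilinear]

theorem energy_homog {t : ℝ} (ht : 0 < t) (y : R3) : energy φ (t • y) = t ^ 2 * energy φ y := by
  simp only [energy, hφ.homog t y ht]
  ring

theorem fderiv_energy_homog {t : ℝ} (ht : 0 < t) {y : R3} (hy : y ≠ 0) (v : R3) :
    fderiv ℝ (energy φ) (t • y) v = t * fderiv ℝ (energy φ) y v := by
  have hty : t • y ≠ 0 := smul_ne_zero ht.ne' hy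
  have h1 : HasFDerivAt (fun z => energy φ (t • z))
      ((fderiv ℝ (energy φ) (t • y)).comp (t • ContinuousLinearMap.id ℝ R3)) y :=
    (hφ.energy_differentiableAt hty).hasFDerivAt.comp y ((hasFDerivAt_id y).const_smul t)
  have h2 : HasFDerivAt (fun z => energy φ (t • z)) (t ^ 2 • fderiv ℝ (energy φ) y) y := by
    simp only [hφ.energy_homog ht]
    exact (hφ.energy_differentiableAt hy).hasFDerivAt.const_mul _
  have := congrArg (fun L : R3 →L[ℝ] ℝ => L v) (h1.unique h2)
  simp at this
  have ht' : t ≠ 0 := ht.ne'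
  apply mul_left_cancel₀ ht'
  rw [this]; ring

/-- Euler's relation for the energy. -/
theorem fderiv_energy_self {y : R3} (hy : y ≠ 0) :
    fderiv ℝ (energy φ) y y = 2 * energy φ y := by
  have hg : HasDerivAt (fun t : ℝ => t • y) y 1 := by
    simpa using (hasDerivAt_id (1 : ℝ)).smul_const y
  have h1 : HasDerivAt (fun t : ℝ => energy φ (t • y)) (fderiv ℝ (energy φ) y y) 1 := by
    have hE : HasFDerivAt (energy φ) (fderiv ℝ (energy φ) y) ((1 : ℝ) • y) := by
      rw [one_smul]; exact (hφ.energy_differentiableAt hy).hasFDerivAt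
    exact hE.comp_hasDerivAt (1 : ℝ) hg
  have h2 : HasDerivAt (fun t : ℝ => energy φ (t • y)) (2 * energy φ y) 1 := by
    have : HasDerivAt (fun t : ℝ => t ^ 2 * energy φ y) (2 * energy φ y) 1 := by
      simpa using (hasDerivAt_pow 2 (1 : ℝ)).mul_const (energy φ y)
    refine this.congr_of_eventuallyEq ?_
    filter_upwards [lt_mem_nhds (zero_lt_one (α := ℝ))] with t ht
    exact hφ.energy_homog ht y
  exact h1.unique h2

/-- Differentiating Euler's relation once more. -/
theorem formOf_hessian_self {y : R3} (hy : y ≠ 0) :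
    formOf (hessian φ y) y y = 2 * energy φ y := by
  rw [hφ.formOf_hessian hy]
  have hg : HasDerivAt (fun t : ℝ => t • y) y 1 := by
    simpa using (hasDerivAt_id (1 : ℝ)).smul_const y
  have h1 : HasDerivAt (fun t : ℝ => fderiv ℝ (energy φ) (t • y) y)
      (fderiv ℝ (fderiv ℝ (energy φ)) y y y) 1 := by
    have hd : HasFDerivAt (fun z => fderiv ℝ (energy φ) z y)
        ((fderiv ℝ (fderiv ℝ (energy φ)) y).flip y) y := by
      have h := (hφ.fderiv_energy_smooth hy).differentiableAt (by simp)
      simpa using h.hasFDerivAt.clm_apply (hasFDerivAt_const y y)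
    exact hd.comp_hasDerivAt_of_eq (1 : ℝ) hg (one_smul ℝ y).symm
  have h2 : HasDerivAt (fun t : ℝ => fderiv ℝ (energy φ) (t • y) y) (2 * energy φ y) 1 := by
    have : HasDerivAt (fun t : ℝ => t * (2 * energy φ y)) (2 * energy φ y) 1 := by
      simpa using (hasDerivAt_id (1 : ℝ)).mul_const (2 * energy φ y)
    refine this.congr_of_eventuallyEq ?_
    filter_upwards [lt_mem_nhds (zero_lt_one (α := ℝ))] with t ht
    rw [hφ.fderiv_energy_homog ht hy, hφ.fderiv_energy_self hy]
  exact h1.unique h2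

/-- Positivity is not part of the definition: `φ² = g(y, y)` is positive by convexity. -/
theorem pos {y : R3} (hy : y ≠ 0) : 0 < φ y := by
  have h := formOf_posDef (hφ.posDef y hy) hy
  rw [hφ.formOf_hessian_self hy] at h
  refine lt_of_le_of_ne (hφ.nonneg y) fun h0 => ?_
  simp [energy, ← h0] at h

theorem radialMap_ne_zero {y : R3} (hy : y ≠ 0) : radialMap φ y ≠ 0 :=
  smul_ne_zero (inv_ne_zero (hφ.pos hy).ne') hy

theorem map_radialMap {y : R3} (hy : y ≠ 0) : φ (radialMap φ y) = 1 := by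
  have h := hφ.pos hy
  rw [radialMap, hφ.homog _ _ (inv_pos.2 h), inv_mul_cancel₀ h.ne']

theorem radialMap_smul {t : ℝ} (ht : 0 < t) (y : R3) :
    radialMap φ (t • y) = radialMap φ y := by
  rw [radialMap, radialMap, hφ.homog _ _ ht, smul_smul, mul_inv, mul_right_comm,
    inv_mul_cancel₀ ht.ne', one_mul]

theorem continuousAt {y : R3} (hy : y ≠ 0) : ContinuousAt φ y :=
  (hφ.smooth y hy).continuousAt

theorem continuousAt_radialMap {y : R3} (hy : y ≠ 0) : ContinuousAt (radialMap φ) y :=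
  ((hφ.continuousAt hy).inv₀ (hφ.pos hy).ne').smul continuousAt_id

theorem continuousAt_hessian {y : R3} (hy : y ≠ 0) (i j : Fin 3) :
    ContinuousAt (fun z => hessian φ z i j) y := by
  have h : ContDiffAt ℝ ∞ (fderiv ℝ (fderiv ℝ (energy φ))) y :=
    (hφ.fderiv_energy_smooth hy).fderiv_right (by simp)
  have h' : ContinuousAt
      (fun z => fderiv ℝ (fderiv ℝ (energy φ)) z (basisVec i) (basisVec j)) y :=
    (h.continuousAt.clm_apply continuousAt_const).clm_apply continuousAt_const
  refine h'.congr ?_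
  filter_upwards [isOpen_ne.mem_nhds hy] with z hz
  rw [hφ.hessian_eq hz]
  rfl

theorem continuousAt_det_hessian {y : R3} (hy : y ≠ 0) :
    ContinuousAt (fun z => (hessian φ z).det) y := by
  have h := fun i j => hφ.continuousAt_hessian hy i j
  simp only [Matrix.det_fin_three]
  exact (((((((h _ _).mul (h _ _)).mul (h _ _)).sub (((h _ _).mul (h _ _)).mul (h _ _))).sub
    (((h _ _).mul (h _ _)).mul (h _ _))).add (((h _ _).mul (h _ _)).mul (h _ _))).add
    (((h _ _).mul (h _ _)).mul (h _ _))).sub (((h _ _).mul (h _ _)).mul (h _ _))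

theorem fderiv_radialMap {y : R3} (hy : y ≠ 0) (a : R3) :
    fderiv ℝ (radialMap φ) y a = (φ y)⁻¹ • a - ((φ y ^ 2)⁻¹ * fderiv ℝ φ y a) • y := by
  have hd := ((hφ.smooth y hy).differentiableAt (by simp)).hasFDerivAt
  have h := ((hasDerivAt_inv (hφ.pos hy).ne').comp_hasFDerivAt y hd).smul (hasFDerivAt_id y)
  have h' : HasFDerivAt (radialMap φ) _ y := h
  rw [h'.fderiv]
  simp [sub_eq_add_neg]

/-- The two-form `μ` pulled back by the radial projection and evaluated on the unit sphere: the
density of `μ` with respect to the surface measure is `√(det g) φ⁻³`. -/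
theorem pullback_inducedVolumeForm {u : R3} (hu : ‖u‖ = 1) :
    ∑ i : Fin 3, u i * inducedVolumeForm φ (radialMap φ u)
          (fderiv ℝ (radialMap φ) u (basisVec (i + 1)))
          (fderiv ℝ (radialMap φ) u (basisVec (i + 2))) =
      √(hessian φ (radialMap φ u)).det * (φ u ^ 3)⁻¹ := by
  have hu0 : u ≠ 0 := by
    rintro rfl
    simp at hu
  have hsq : u 0 ^ 2 + u 1 ^ 2 + u 2 ^ 2 = 1 := by
    have := EuclideanSpace.norm_sq_eq u
    rw [hu] at this
    simpa [Fin.sum_univ_three] using this.symm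
  have hpos := (hφ.pos hu0).ne'
  simp only [inducedVolumeForm, hφ.map_radialMap hu0, hφ.fderiv_radialMap hu0, Fin.sum_univ_three]
  generalize √(hessian φ (radialMap φ u)).det = s
  simp only [radialMap, Matrix.det_fin_three]
  simp [-mul_eq_mul_left_iff]
  field_simp
  linear_combination s * φ u ^ 2 * hsq

end IsMinkowski

/-! ### Integration over the indicatrix -/

namespace IsMinkowski

variable {φ : R3 → ℝ} (hφ : IsMinkowski φ)

theorem sphere_ne_zero (u : Metric.sphere (0 : R3) 1) : (u : R3) ≠ 0 :=
  ne_zero_of_mem_unit_sphere u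

include hφ

/-- The integral over the indicatrix as an integral of a function over the Euclidean sphere. -/
theorem indicatrixIntegral_eq (h : R3 → ℝ) :
    indicatrixIntegral φ h = ∫ u : Metric.sphere (0 : R3) 1,
      h (radialMap φ u) * (√(hessian φ (radialMap φ u)).det * (φ u ^ 3)⁻¹)
        ∂(volume : Measure R3).toSphere := by
  unfold indicatrixIntegral
  congr 1
  ext u
  rw [hφ.pullback_inducedVolumeForm (by simp)]

theorem continuous_comp_radialMap {h : R3 → ℝ} (hh : ∀ y ≠ 0, ContinuousAt h y) :
    Continuous fun u : Metric.sphere (0 : R3) 1 => h (radialMap φ u) :=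
  continuous_iff_continuousAt.2 fun u =>
    ContinuousAt.comp (f := fun u : Metric.sphere (0 : R3) 1 => radialMap φ u)
      (hh _ (hφ.radialMap_ne_zero (sphere_ne_zero u)))
      (ContinuousAt.comp (f := fun u : Metric.sphere (0 : R3) 1 => (u : R3))
        (hφ.continuousAt_radialMap (sphere_ne_zero u)) continuous_subtype_val.continuousAt)

theorem continuous_sphere : Continuous fun u : Metric.sphere (0 : R3) 1 => φ u :=
  continuous_iff_continuousAt.2 fun u =>
    ContinuousAt.comp (f := fun u : Metric.sphere (0 : R3) 1 => (u : R3))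
        (hφ.continuousAt (sphere_ne_zero u)) continuous_subtype_val.continuousAt

theorem continuousAt_sqrt_det {y : R3} (hy : y ≠ 0) :
    ContinuousAt (fun z => √(hessian φ z).det) y :=
  (hφ.continuousAt_det_hessian hy).sqrt

theorem continuous_integrand {h : R3 → ℝ} (hh : ∀ y ≠ 0, ContinuousAt h y) :
    Continuous fun u : Metric.sphere (0 : R3) 1 =>
      h (radialMap φ u) * (√(hessian φ (radialMap φ u)).det * (φ u ^ 3)⁻¹) :=
  (hφ.continuous_comp_radialMap hh).mul
    ((hφ.continuous_comp_radialMap fun _ hy => hφ.continuousAt_sqrt_det hy).mul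
      ((hφ.continuous_sphere.pow 3).inv₀ fun u => pow_ne_zero 3 (hφ.pos (sphere_ne_zero u)).ne'))

theorem integrable_integrand {h : R3 → ℝ} (hh : ∀ y ≠ 0, ContinuousAt h y) :
    Integrable (fun u : Metric.sphere (0 : R3) 1 =>
      h (radialMap φ u) * (√(hessian φ (radialMap φ u)).det * (φ u ^ 3)⁻¹))
      (volume : Measure R3).toSphere :=
  (hφ.continuous_integrand hh).integrable_of_hasCompactSupport (HasCompactSupport.of_compactSpace _)

theorem indicatrixIntegral_congr {h k : R3 → ℝ} (hk : ∀ y ≠ 0, h y = k y) :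
    indicatrixIntegral φ h = indicatrixIntegral φ k := by
  rw [hφ.indicatrixIntegral_eq, hφ.indicatrixIntegral_eq]
  congr 1
  ext u
  rw [hk _ (hφ.radialMap_ne_zero (sphere_ne_zero u))]

theorem indicatrixIntegral_const_mul (c : ℝ) (h : R3 → ℝ) :
    indicatrixIntegral φ (fun y => c * h y) = c * indicatrixIntegral φ h := by
  rw [hφ.indicatrixIntegral_eq, hφ.indicatrixIntegral_eq, ← integral_const_mul]
  simp only [mul_assoc]

theorem indicatrixIntegral_sum {ι : Type*} (s : Finset ι) {h : ι → R3 → ℝ}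
    (hh : ∀ i ∈ s, ∀ y ≠ 0, ContinuousAt (h i) y) :
    indicatrixIntegral φ (fun y => ∑ i ∈ s, h i y) = ∑ i ∈ s, indicatrixIntegral φ (h i) := by
  simp only [hφ.indicatrixIntegral_eq, Finset.sum_mul]
  exact integral_finsetSum _ fun i hi => hφ.integrable_integrand (hh i hi)

theorem indicatrixIntegral_nonneg {h : R3 → ℝ} (h0 : ∀ y ≠ 0, 0 ≤ h y) :
    0 ≤ indicatrixIntegral φ h := by
  rw [hφ.indicatrixIntegral_eq]
  refine integral_nonneg fun u => ?_
  have h1 := h0 _ (hφ.radialMap_ne_zero (sphere_ne_zero u))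
  have h2 := hφ.pos (sphere_ne_zero u)
  positivity

theorem indicatrixIntegral_pos {h : R3 → ℝ} (hh : ∀ y ≠ 0, ContinuousAt h y)
    (h0 : ∀ y ≠ 0, 0 ≤ h y) {y : R3} (hy : y ≠ 0) (hpos : 0 < h (radialMap φ y)) :
    0 < indicatrixIntegral φ h := by
  rw [hφ.indicatrixIntegral_eq]
  have hn : 0 < ‖y‖ := norm_pos_iff.2 hy
  refine (hφ.continuous_integrand hh).integral_pos_of_hasCompactSupport_nonneg_nonzero
    (HasCompactSupport.of_compactSpace _) (fun u => ?_)
    (x := ⟨‖y‖⁻¹ • y, by simp [norm_smul, hn.ne']⟩) ?_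
  · have h1 := h0 _ (hφ.radialMap_ne_zero (sphere_ne_zero u))
    have h2 := hφ.pos (sphere_ne_zero u)
    simp only [Pi.zero_apply]
    positivity
  · have h1 : radialMap φ (‖y‖⁻¹ • y) = radialMap φ y := hφ.radialMap_smul (inv_pos.2 hn) y
    have h2 : 0 < φ (‖y‖⁻¹ • y) := hφ.pos (smul_ne_zero (inv_ne_zero hn.ne') hy)
    have h3 := (hφ.posDef _ (hφ.radialMap_ne_zero hy)).det_pos
    simp only [h1]
    positivity

/-- The integral over the indicatrix is the integral of the radially constant extension over the
unit ball `{φ < 1}`, up to the factor `3`: integrate in polar coordinates. The right hand side is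
visibly compatible with linear changes of coordinates. -/
theorem indicatrixIntegral_eq_integral {h : R3 → ℝ} (hh : ∀ y ≠ 0, ContinuousAt h y) :
    indicatrixIntegral φ h = 3 * ∫ y : R3, {y | φ y < 1}.indicator
      (fun y => h (radialMap φ y) * √(hessian φ (radialMap φ y)).det) y := by
  set k : R3 → ℝ := fun y => h (radialMap φ y) * √(hessian φ (radialMap φ y)).det with hk
  set f : R3 → ℝ := {y | φ y < 1}.indicator k with hf
  set ν := Measure.volumeIoiPow 2 with hν
  have hkc : Continuous fun u : Metric.sphere (0 : R3) 1 => k u :=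
    (hφ.continuous_comp_radialMap hh).mul
      (hφ.continuous_comp_radialMap fun _ hy => hφ.continuousAt_sqrt_det hy)
  have h1 : ∫ y, f y = ∫ z : Metric.sphere (0 : R3) 1 × Ioi (0 : ℝ), f (z.2.1 • z.1.1)
      ∂((volume : Measure R3).toSphere.prod ν) := by
    have hmp := (volume : Measure R3).measurePreserving_homeomorphUnitSphereProd
    rw [finrank_euclideanSpace_fin] at hmp
    have := hmp.integral_comp (Homeomorph.measurableEmbedding _)
      (fun z : Metric.sphere (0 : R3) 1 × Ioi (0 : ℝ) => f (z.2.1 • z.1.1))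
    rw [← this]
    rw [show (∫ y, f y) = ∫ y in ({0}ᶜ : Set R3), f y by rw [restrict_compl_singleton],
      ← integral_subtype_comap (measurableSet_singleton _).compl]
    congr 1
    ext x
    have hx : ‖(x : R3)‖ ≠ 0 := norm_ne_zero_iff.2 x.2
    simp [smul_smul, hx]
  -- on the ray through `u` the integrand is constant up to `r = (φ u)⁻¹` and vanishes beyond
  have hfk : ∀ (u : Metric.sphere (0 : R3) 1) (r : Ioi (0 : ℝ)), f (r.1 • u.1) =
      k u * (Iio (⟨(φ u)⁻¹, inv_pos.2 (hφ.pos (sphere_ne_zero u))⟩ : Ioi (0 : ℝ))).indicator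
        (fun _ => (1 : ℝ)) r := by
    intro u r
    have hr : 0 < r.1 := r.2
    have hu := hφ.pos (sphere_ne_zero u)
    have hiff : φ (r.1 • u.1) < 1 ↔
        r < (⟨(φ u)⁻¹, inv_pos.2 hu⟩ : Ioi (0 : ℝ)) := by
      rw [hφ.homog _ _ hr, ← Subtype.coe_lt_coe, lt_inv_comm₀ hr hu, ← one_div, lt_div_iff₀ hr,
        mul_comm]
    by_cases hc : φ (r.1 • u.1) < 1
    · rw [hf, indicator_of_mem (by exact hc), indicator_of_mem (by exact hiff.1 hc), hk]
      simp only [hφ.radialMap_smul hr, mul_one]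
    · rw [hf, indicator_of_notMem (by exact hc),
        indicator_of_notMem (by exact fun h => hc (hiff.2 h)), mul_zero]
  have hvol : ∀ x : Ioi (0 : ℝ), ν.real (Iio x) = x.1 ^ 3 / 3 := by
    intro x
    have hx : 0 < x.1 := x.2
    rw [Measure.real, hν, Measure.volumeIoiPow_apply_Iio, ENNReal.toReal_ofReal (by positivity)]
    norm_num
  -- the integrand in polar coordinates is bounded with bounded support
  have hint : Integrable (fun z : Metric.sphere (0 : R3) 1 × Ioi (0 : ℝ) => f (z.2.1 • z.1.1))
      ((volume : Measure R3).toSphere.prod ν) := by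
    obtain ⟨R, hR0, hR⟩ : ∃ R : ℝ, 0 < R ∧ ∀ u : Metric.sphere (0 : R3) 1, (φ u)⁻¹ ≤ R := by
      have hc : Continuous fun u : Metric.sphere (0 : R3) 1 => (φ u)⁻¹ :=
        hφ.continuous_sphere.inv₀ fun u => (hφ.pos (sphere_ne_zero u)).ne'
      obtain ⟨R, hR⟩ := (isCompact_range hc).bddAbove
      exact ⟨max R 1, by positivity, fun u => (hR (mem_range_self u)).trans (le_max_left _ _)⟩
    have hd : Integrable (fun z : Metric.sphere (0 : R3) 1 × Ioi (0 : ℝ) =>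
        ‖k z.1‖ * (Iio (⟨R, hR0⟩ : Ioi (0 : ℝ))).indicator (fun _ => (1 : ℝ)) z.2)
        ((volume : Measure R3).toSphere.prod ν) := by
      refine Integrable.mul_prod (f := fun u : Metric.sphere (0 : R3) 1 => ‖k u‖)
        (g := (Iio (⟨R, hR0⟩ : Ioi (0 : ℝ))).indicator (fun _ => (1 : ℝ))) ?_ ?_
      · exact hkc.norm.integrable_of_hasCompactSupport (HasCompactSupport.of_compactSpace _)
      · rw [integrable_indicator_iff measurableSet_Iio]
        refine integrableOn_const ?_
        rw [hν, Measure.volumeIoiPow_apply_Iio]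
        exact ENNReal.ofReal_ne_top
    refine hd.mono' ?_ (Filter.Eventually.of_forall fun z => ?_)
    · have hm : Measurable fun z : Metric.sphere (0 : R3) 1 × Ioi (0 : ℝ) =>
          {z : Metric.sphere (0 : R3) 1 × Ioi (0 : ℝ) | z.2.1 < (φ z.1)⁻¹}.indicator
            (fun z => k z.1) z := by
        refine Measurable.indicator (hkc.comp continuous_fst).measurable ?_
        refine (isOpen_lt ?_ ?_).measurableSet
        · fun_prop
        · exact (hφ.continuous_sphere.comp continuous_fst).inv₀
            fun z => (hφ.pos (sphere_ne_zero z.1)).ne'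
      refine hm.aestronglyMeasurable.congr (Filter.Eventually.of_forall fun z => ?_)
      simp only [hfk]
      by_cases hz : z.2.1 < (φ z.1)⁻¹
      · rw [indicator_of_mem (by exact hz), indicator_of_mem (by exact hz), mul_one]
      · rw [indicator_of_notMem (by exact hz), indicator_of_notMem (by exact hz), mul_zero]
    · rw [hfk, norm_mul]
      refine mul_le_mul_of_nonneg_left ?_ (norm_nonneg _)
      by_cases hz : z.2.1 < (φ z.1)⁻¹
      · rw [indicator_of_mem (by exact hz),
          indicator_of_mem (show z.2 ∈ Iio (⟨R, hR0⟩ : Ioi (0 : ℝ)) from hz.trans_le (hR z.1))]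
        simp
      · rw [indicator_of_notMem (by exact hz), norm_zero]
        exact indicator_nonneg (fun _ _ => zero_le_one) _
  rw [h1, integral_prod _ hint, hφ.indicatrixIntegral_eq, ← integral_const_mul]
  congr 1
  ext u
  simp only [hfk, integral_const_mul, integral_indicator measurableSet_Iio]
  simp only [integral_const, MeasurableSet.univ, measureReal_restrict_apply, univ_inter, hvol,
    smul_eq_mul, hk]
  have := (hφ.pos (sphere_ne_zero u)).ne'
  field_simp

end IsMinkowski

/-! ### Linear changes of coordinates and the averaged metric -/

theorem energy_comp (φ : R3 → ℝ) (A : R3 ≃L[ℝ] R3) :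
    energy (fun y => φ (A y)) = energy φ ∘ A := rfl

theorem fderiv_energy_comp (φ : R3 → ℝ) (A : R3 ≃L[ℝ] R3) (y v : R3) :
    fderiv ℝ (energy fun y => φ (A y)) y v = fderiv ℝ (energy φ) (A y) (A v) := by
  rw [energy_comp, A.comp_right_fderiv]
  rfl

namespace IsMinkowski

variable {φ : R3 → ℝ} (hφ : IsMinkowski φ)
include hφ

theorem formOf_hessian_comp (A : R3 ≃L[ℝ] R3) {y : R3} (hy : y ≠ 0) (v w : R3) :
    formOf (hessian (fun y => φ (A y)) y) v w = formOf (hessian φ (A y)) (A v) (A w) := by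
  have hAy : A y ≠ 0 := by simpa using hy
  have key : ∀ v w : R3, fderiv ℝ (fun z => fderiv ℝ (energy fun y => φ (A y)) z w) y v =
      fderiv ℝ (fderiv ℝ (energy φ)) (A y) (A v) (A w) := by
    intro v w
    have h := ((hφ.fderiv_energy_smooth hAy).differentiableAt (by simp)).hasFDerivAt
    have h1 : HasFDerivAt (fun z => fderiv ℝ (energy φ) z (A w))
        ((fderiv ℝ (fderiv ℝ (energy φ)) (A y)).flip (A w)) (A y) := by
      simpa using h.clm_apply (hasFDerivAt_const (A w) (A y))
    have h2 := h1.comp y A.hasFDerivAt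
    simp only [fderiv_energy_comp]
    have h3 : HasFDerivAt (fun z => fderiv ℝ (energy φ) (A z) (A w)) _ y := h2
    rw [h3.fderiv]
    rfl
  rw [hφ.formOf_hessian hAy]
  let B : R3 →L[ℝ] R3 →L[ℝ] ℝ :=
    (fderiv ℝ (fderiv ℝ (energy φ)) (A y)).bilinearComp (A : R3 →L[ℝ] R3) (A : R3 →L[ℝ] R3)
  have hB : hessian (fun y => φ (A y)) y = Matrix.of fun i j => B (basisVec i) (basisVec j) := by
    ext i j
    exact key _ _
  rw [hB, formOf_of_bilinear]
  rfl

theorem comp (A : R3 ≃L[ℝ] R3) : IsMinkowski fun y => φ (A y) where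
  nonneg y := hφ.nonneg _
  homog t y ht := by rw [map_smul, hφ.homog _ _ ht]
  smooth y hy := (hφ.smooth (A y) (by simpa using hy)).comp y A.contDiff.contDiffAt
  posDef y hy := by
    have hAy : A y ≠ 0 := by simpa using hy
    refine posDef_of_formOf (fun i j => ?_) fun v hv => ?_
    · rw [← formOf_basisVec (hessian _ y) i j, ← formOf_basisVec (hessian _ y) j i,
        hφ.formOf_hessian_comp A hy, hφ.formOf_hessian_comp A hy,
        formOf_symm (hφ.posDef _ hAy)]
    · rw [hφ.formOf_hessian_comp A hy]
      exact formOf_posDef (hφ.posDef _ hAy) (by simpa using hv)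

/-- Integrals over indicatrices do not depend on the linear coordinates. -/
theorem indicatrixIntegral_comp (A : R3 ≃L[ℝ] R3) {h : R3 → ℝ}
    (hh : ∀ y ≠ 0, ContinuousAt h y) :
    indicatrixIntegral (fun y => φ (A y)) (fun y => h (A y)) = indicatrixIntegral φ h := by
  have hA : ∀ y ≠ 0, ContinuousAt (fun y => h (A y)) y := fun y hy =>
    ContinuousAt.comp (f := A) (hh (A y) (by simpa using hy)) A.continuous.continuousAt
  rw [(hφ.comp A).indicatrixIntegral_eq_integral hA, hφ.indicatrixIntegral_eq_integral hh]
  congr 1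
  set d : ℝ := LinearMap.det ((A : R3 →L[ℝ] R3) : R3 →ₗ[ℝ] R3) with hd
  have hd0 : d ≠ 0 := A.toLinearEquiv.isUnit_det'.ne_zero
  set f : R3 → ℝ := {y | φ y < 1}.indicator
    (fun y => h (radialMap φ y) * √(hessian φ (radialMap φ y)).det) with hf
  have hmap := Measure.map_linearMap_addHaar_eq_smul_addHaar (volume : Measure R3) hd0
  have hint : ∫ y, |d| * f (A y) = ∫ y, f y := by
    have h1 := A.toHomeomorph.toMeasurableEquiv.measurableEmbedding.integral_map
      (μ := volume) f
    have h2 : Measure.map A.toHomeomorph.toMeasurableEquiv (volume : Measure R3) =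
      ENNReal.ofReal |d⁻¹| • volume := hmap
    rw [h2, integral_smul_measure, ENNReal.toReal_ofReal (abs_nonneg _), smul_eq_mul] at h1
    have h3 : ∫ y, f (A y) = |d⁻¹| * ∫ y, f y := h1.symm
    rw [integral_const_mul, h3, ← mul_assoc, ← abs_mul, mul_inv_cancel₀ hd0, abs_one, one_mul]
  rw [← hint]
  refine integral_congr_ae ?_
  filter_upwards [compl_mem_ae_iff.2 (measure_singleton (0 : R3))] with y hy
  have hy : y ≠ 0 := hy
  have hr : A (radialMap (fun y => φ (A y)) y) = radialMap φ (A y) := by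
    simp [radialMap]
  have hr0 := (hφ.comp A).radialMap_ne_zero hy
  by_cases hc : φ (A y) < 1
  · rw [hf, indicator_of_mem (by exact hc), indicator_of_mem (by exact hc),
      det_of_formOf (A : R3 →L[ℝ] R3) (hφ.formOf_hessian_comp A hr0), hr,
      Real.sqrt_mul (sq_nonneg _), Real.sqrt_sq_eq_abs, ← hd]
    ring
  · rw [hf, indicator_of_notMem (by exact hc), indicator_of_notMem (by exact hc), mul_zero]

theorem continuousAt_formOf_hessian {y : R3} (hy : y ≠ 0) (v w : R3) :
    ContinuousAt (fun z => formOf (hessian φ z) v w) y := by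
  unfold formOf
  exact tendsto_finsetSum _ fun i _ => tendsto_finsetSum _ fun j _ =>
    continuousAt_const.mul (hφ.continuousAt_hessian hy i j)

theorem formOf_averagedGram (v w : R3) :
    formOf (averagedGram φ) v w = indicatrixIntegral φ fun y => formOf (hessian φ y) v w := by
  have hc : ∀ i j, ∀ y ≠ 0, ContinuousAt (fun z => v i * w j * hessian φ z i j) y :=
    fun i j y hy => continuousAt_const.mul (hφ.continuousAt_hessian hy i j)
  simp only [formOf, averagedGram, Matrix.of_apply]
  rw [hφ.indicatrixIntegral_sum _ fun i _ y hy =>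
    tendsto_finsetSum _ fun j _ => hc i j y hy]
  refine Finset.sum_congr rfl fun i _ => ?_
  rw [hφ.indicatrixIntegral_sum _ fun j _ => hc i j]
  refine Finset.sum_congr rfl fun j _ => ?_
  rw [hφ.indicatrixIntegral_const_mul]

theorem formOf_averagedGram_comp (A : R3 ≃L[ℝ] R3) (v w : R3) :
    formOf (averagedGram fun y => φ (A y)) v w = formOf (averagedGram φ) (A v) (A w) := by
  rw [(hφ.comp A).formOf_averagedGram, hφ.formOf_averagedGram,
    ← hφ.indicatrixIntegral_comp A fun y hy => hφ.continuousAt_formOf_hessian hy _ _]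
  exact (hφ.comp A).indicatrixIntegral_congr fun y hy => hφ.formOf_hessian_comp A hy v w

theorem averagedGram_posDef : (averagedGram φ).PosDef := by
  refine posDef_of_formOf (fun i j => ?_) fun v hv => ?_
  · rw [← formOf_basisVec (averagedGram φ) i j, ← formOf_basisVec (averagedGram φ) j i,
      hφ.formOf_averagedGram, hφ.formOf_averagedGram]
    exact hφ.indicatrixIntegral_congr fun y hy => formOf_symm (hφ.posDef y hy) _ _
  · rw [hφ.formOf_averagedGram]
    refine hφ.indicatrixIntegral_pos (fun y hy => hφ.continuousAt_formOf_hessian hy _ _)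
      (fun y hy => (formOf_posDef (hφ.posDef y hy) hv).le) hv
      (formOf_posDef (hφ.posDef _ (hφ.radialMap_ne_zero hv)) hv)

end IsMinkowski

/-! ### Cross products and three-forms -/

theorem eq_of_formOf_left {G : Matrix (Fin 3) (Fin 3) ℝ} (hG : G.PosDef) {v v' : R3}
    (h : ∀ w, formOf G v w = formOf G v' w) : v = v' := by
  by_contra hne
  have h1 := formOf_posDef hG (sub_ne_zero.2 hne)
  have h2 := h (v - v')
  simp only [← formOfCLM_apply, map_sub, _root_.sub_apply] at h1 h2
  linarith

theorem formOf_cross {G : Matrix (Fin 3) (Fin 3) ℝ} (hG : G.PosDef) (a b w : R3) :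
    formOf G (cross G a b) w =
      √G.det * Matrix.det !![a 0, a 1, a 2; b 0, b 1, b 2; w 0, w 1, w 2] := by
  rw [formOf_symm hG, formOf_eq_dotProduct, cross_spec G hG]

theorem cross_eq_sum (G : Matrix (Fin 3) (Fin 3) ℝ) (a b : R3) :
    cross G a b = ∑ i, a i • cross G (basisVec i) b := by
  have h : WithLp.ofLp a = ∑ i, a i • WithLp.ofLp (basisVec i) := by
    conv_lhs => rw [eq_sum_basisVec a]
    simp
  simp only [cross]
  conv_lhs => rw [h]
  simp only [map_sum, map_smul, LinearMap.sum_apply, LinearMap.smul_apply, Matrix.mulVec_sum,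
    Matrix.mulVec_smul, Finset.smul_sum, WithLp.toLp_sum]
  refine Finset.sum_congr rfl fun i _ => ?_
  rw [smul_comm, WithLp.toLp_smul]

theorem continuous_cross (G : Matrix (Fin 3) (Fin 3) ℝ) (a : R3) : Continuous (cross G a) := by
  have h : Continuous fun b : R3 => crossProduct (WithLp.ofLp a) (WithLp.ofLp b) :=
    (LinearMap.continuous_of_finiteDimensional (crossProduct (WithLp.ofLp a))).comp
      (PiLp.continuous_ofLp 2 _)
  have h2 : Continuous fun b : R3 =>
      √G.det • (G⁻¹ *ᵥ crossProduct (WithLp.ofLp a) (WithLp.ofLp b)) :=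
    Continuous.fun_const_smul (Continuous.matrix_mulVec continuous_const h) _
  exact (PiLp.continuous_toLp 2 _).comp h2

/-- Grassmann's identity for the cross product of `G`. -/
theorem cross_cross_self {G : Matrix (Fin 3) (Fin 3) ℝ} (hG : G.PosDef) (y v : R3) :
    cross G (cross G y v) y = formOf G y y • v - formOf G y v • y := by
  have hd : G.det ≠ 0 := hG.det_pos.ne'
  have hs : ∀ i j, G i j = G j i := fun i j => by simpa using (hG.isHermitian.apply i j).symm
  have hadj : G.det • G⁻¹ = G.adjugate := by
    rw [Matrix.inv_def, Ring.inverse_eq_inv', smul_smul, mul_inv_cancel₀ hd, one_smul]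
  have key : crossProduct (G.adjugate *ᵥ crossProduct (WithLp.ofLp y) (WithLp.ofLp v))
      (WithLp.ofLp y) = G *ᵥ WithLp.ofLp (formOf G y y • v - formOf G y v • y) := by
    rw [Matrix.adjugate_fin_three]
    ext k
    fin_cases k <;>
    · simp [cross_apply, Matrix.mulVec, dotProduct, Fin.sum_univ_three, formOf, hs 1 0, hs 2 0,
        hs 2 1]
      ring
  have h1 : WithLp.ofLp (cross G (cross G y v) y) =
      G⁻¹ *ᵥ crossProduct (G.adjugate *ᵥ crossProduct (WithLp.ofLp y) (WithLp.ofLp v))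
      (WithLp.ofLp y) := by
    rw [← hadj]
    simp only [cross, map_smul, LinearMap.smul_apply, Matrix.mulVec_smul, Matrix.smul_mulVec,
      smul_smul, Real.mul_self_sqrt hG.det_pos.le]
  rw [key, Matrix.mulVec_mulVec, Matrix.nonsing_inv_mul G hd.isUnit, Matrix.one_mulVec] at h1
  exact WithLp.ofLp_injective 2 h1

/-- In dimension three, a bilinear map whose lowered trilinear form is totally antisymmetric is a
multiple of the cross product. -/
theorem exists_eq_smul_cross {G : Matrix (Fin 3) (Fin 3) ℝ} (hG : G.PosDef)
    (D : R3 →L[ℝ] R3 →L[ℝ] R3)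
    (h₁ : ∀ u v w, formOf G (D u v) w = -formOf G (D v u) w)
    (h₂ : ∀ u v w, formOf G (D u v) w = -formOf G (D u w) v) :
    ∃ c : ℝ, ∀ u v, D u v = c • cross G u v := by
  have hs : √G.det ≠ 0 := (Real.sqrt_pos.2 hG.det_pos).ne'
  set T : Fin 3 → Fin 3 → Fin 3 → ℝ := fun i j k =>
    formOf G (D (basisVec i) (basisVec j)) (basisVec k) with hT
  have a₁ : ∀ i j k, T i j k = -T j i k := fun i j k => h₁ _ _ _
  have a₂ : ∀ i j k, T i j k = -T i k j := fun i j k => h₂ _ _ _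
  have z₁ : ∀ i k, T i i k = 0 := fun i k => by linarith [a₁ i i k]
  have z₂ : ∀ i k, T i k k = 0 := fun i k => by linarith [a₂ i k k]
  have z₃ : ∀ i k, T i k i = 0 := fun i k => by linarith [a₂ i k i, z₁ i k]
  have e₁ : T 1 0 2 = -T 0 1 2 := a₁ _ _ _
  have e₂ : T 0 2 1 = -T 0 1 2 := a₂ _ _ _
  have e₃ : T 2 0 1 = T 0 1 2 := by rw [a₁, e₂, neg_neg]
  have e₄ : T 1 2 0 = T 0 1 2 := by rw [a₂, e₁, neg_neg]
  have e₅ : T 2 1 0 = -T 0 1 2 := by rw [a₂, e₃]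
  refine ⟨T 0 1 2 / √G.det, fun u v => eq_of_formOf_left hG fun w => ?_⟩
  have hexp : formOf G (D u v) w = ∑ i, ∑ j, ∑ k, u i * v j * w k * T i j k := by
    conv_lhs => rw [eq_sum_basisVec u, eq_sum_basisVec v, eq_sum_basisVec w]
    simp only [hT, ← formOfCLM_apply, Fin.sum_univ_three, map_add, map_smul, _root_.add_apply,
      _root_.smul_apply, smul_eq_mul]
    ring
  have hc : formOf G ((T 0 1 2 / √G.det) • cross G u v) w =
      T 0 1 2 / √G.det * formOf G (cross G u v) w := by
    simp only [← formOfCLM_apply, map_smul, _root_.smul_apply, smul_eq_mul]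
  rw [hexp, hc, formOf_cross hG]
  generalize √G.det = s at hs
  rw [Matrix.det_fin_three]
  simp only [Fin.sum_univ_three, z₁, z₂, z₃, e₁, e₂, e₃, e₄, e₅]
  simp
  field_simp
  ring

/-- A trilinear-form identity behind the uniqueness of metric connections with totally
antisymmetric torsion: if `d` is skew in its last two arguments and so is its skew-symmetrization
in the first two, then `d` is totally skew. -/
theorem skew_of_skew_skew {V : Type*} {d : V → V → V → ℝ}
    (h₁ : ∀ u v w, d u v w = -d u w v)
    (h₂ : ∀ u v w, d u v w - d v u w = -(d u w v - d w u v)) (u v w : V) :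
    d u v w = -d v u w := by
  linarith [h₁ u v w, h₁ v u w, h₁ v w u, h₁ w u v, h₁ u w v, h₁ w v u, h₂ u v w, h₂ v u w,
    h₂ v w u, h₂ w u v, h₂ u w v, h₂ w v u]

/-! ### Energies invariant under rotations -/

/-- If the energy of a Minkowski norm is annihilated by the infinitesimal rotations
`y ↦ a ×_G y`, then it is a multiple of the quadratic form of `G`: its differential at `y` is
proportional to `G(y, ·)`, so that its quotient by that form is constant. -/
theorem IsMinkowski.exists_sq_eq_of_rotation {φ : R3 → ℝ} (hφ : IsMinkowski φ)
    {G : Matrix (Fin 3) (Fin 3) ℝ} (hG : G.PosDef)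
    (h : ∀ y ≠ 0, ∀ i, fderiv ℝ (energy φ) y (cross G (basisVec i) y) = 0) :
    ∃ c : ℝ, ∀ y, φ y ^ 2 = c * formOf G y y := by
  have hq : ∀ y : R3, HasFDerivAt (fun y => formOf G y y) ((2 : ℝ) • formOfCLM G y) y := by
    intro y
    have h1 := ((formOfCLM G).hasFDerivAt (x := y)).clm_apply (hasFDerivAt_id y)
    simp only [formOfCLM_apply, id] at h1
    refine h1.congr_fderiv ?_
    ext v
    simp [formOfCLM_apply, formOf_symm hG v y, two_mul]
  -- the rotation about the axis `y × v` moves `y` in the direction of the part of `v`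
  -- orthogonal to `y`, so the differential at `y` vanishes on the orthogonal complement of `y`
  have hprop : ∀ y ≠ 0, ∀ v, formOf G y y * fderiv ℝ (energy φ) y v =
      formOf G y v * (2 * energy φ y) := by
    intro y hy v
    have h1 : fderiv ℝ (energy φ) y (cross G (cross G y v) y) = 0 := by
      rw [cross_eq_sum, map_sum]
      exact Finset.sum_eq_zero fun i _ => by rw [map_smul, h y hy i, smul_zero]
    rw [cross_cross_self hG, map_sub, map_smul, map_smul, hφ.fderiv_energy_self hy] at h1
    simpa [sub_eq_zero] using h1
  have hder : ∀ y ∈ ({0}ᶜ : Set R3),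
      HasFDerivAt (fun y => energy φ y / formOf G y y) (0 : R3 →L[ℝ] ℝ) y := by
    intro y hy
    have hy : y ≠ 0 := hy
    have hpos := (formOf_posDef hG hy).ne'
    have h1 := (hφ.energy_differentiableAt hy).hasFDerivAt.mul
      (HasDerivAt.comp_hasFDerivAt (f := fun y => formOf G y y) y (hasDerivAt_inv hpos) (hq y))
    refine h1.congr_fderiv ?_
    ext v
    have := hprop y hy v
    simp [formOfCLM_apply]
    field_simp
    linear_combination this
  have hconn : IsPreconnected ({0}ᶜ : Set R3) :=
    (isConnected_compl_singleton_of_one_lt_rank (by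
      rw [← Module.finrank_eq_rank, finrank_euclideanSpace_fin]; norm_num) 0).isPreconnected
  obtain ⟨c, hc⟩ := isOpen_compl_singleton.exists_is_const_of_fderiv_eq_zero hconn
    (fun y hy => (hder y hy).differentiableAt.differentiableWithinAt)
    (fun y hy => (hder y hy).fderiv)
  refine ⟨2 * c, fun y => ?_⟩
  by_cases hy : y = 0
  · simp [hy, hφ.map_zero, formOf]
  · have hpos := (formOf_posDef hG hy).ne'
    have := hc y hy
    rw [div_eq_iff hpos, energy] at this
    linarith

/-! ### Charts and coordinates of vector fields -/

section Charts

variable {M : Type*} [TopologicalSpace M] [ChartedSpace R3 M]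
  {e : OpenPartialHomeomorph M R3}

theorem mdifferentiable_of_mem_maximalAtlas (he : e ∈ IsManifold.maximalAtlas (𝓡 3) ∞ M) :
    e.MDifferentiable (𝓡 3) 𝓘(ℝ, R3) :=
  ⟨(contMDiffOn_of_mem_maximalAtlas he).mdifferentiableOn (by simp),
    (contMDiffOn_symm_of_mem_maximalAtlas he).mdifferentiableOn (by simp)⟩

/-- The coordinates of tangent vectors at `p` in the chart `e`, as a linear equivalence. -/
def coordsEquiv (he : e ∈ IsManifold.maximalAtlas (𝓡 3) ∞ M) {p : M} (hp : p ∈ e.source) :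
    TangentSpace (𝓡 3) p ≃L[ℝ] R3 :=
  (mdifferentiable_of_mem_maximalAtlas he).mfderiv hp

theorem coordsEquiv_apply (he : e ∈ IsManifold.maximalAtlas (𝓡 3) ∞ M) {p : M}
    (hp : p ∈ e.source) (v : TangentSpace (𝓡 3) p) : coordsEquiv he hp v = coords e p v := rfl

theorem coordsEquiv_symm_apply (he : e ∈ IsManifold.maximalAtlas (𝓡 3) ∞ M) {p : M}
    (hp : p ∈ e.source) (y : R3) : (coordsEquiv he hp).symm y = ofCoords e p y := by
  have h : (mfderiv (𝓡 3) 𝓘(ℝ, R3) e p) =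
      ((coordsEquiv he hp : TangentSpace (𝓡 3) p ≃L[ℝ] R3) : TangentSpace (𝓡 3) p →L[ℝ] R3) := rfl
  unfold ofCoords
  rw [h]
  exact (congrArg (fun L : R3 →L[ℝ] TangentSpace (𝓡 3) p => L y)
    (ContinuousLinearMap.inverse_equiv (coordsEquiv he hp))).symm

theorem coords_ofCoords (he : e ∈ IsManifold.maximalAtlas (𝓡 3) ∞ M) {p : M}
    (hp : p ∈ e.source) (y : R3) : coords e p (ofCoords e p y) = y := by
  rw [← coordsEquiv_symm_apply he hp, ← coordsEquiv_apply he hp]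
  exact (coordsEquiv he hp).apply_symm_apply y

theorem ofCoords_coords (he : e ∈ IsManifold.maximalAtlas (𝓡 3) ∞ M) {p : M}
    (hp : p ∈ e.source) (v : TangentSpace (𝓡 3) p) : ofCoords e p (coords e p v) = v := by
  rw [← coordsEquiv_symm_apply he hp, ← coordsEquiv_apply he hp]
  exact (coordsEquiv he hp).symm_apply_apply v

theorem isInvertible_mfderiv (he : e ∈ IsManifold.maximalAtlas (𝓡 3) ∞ M) {p : M}
    (hp : p ∈ e.source) : (mfderiv (𝓡 3) 𝓘(ℝ, R3) e p).IsInvertible :=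
  ⟨coordsEquiv he hp, rfl⟩

theorem isInvertible_mfderiv_symm (he : e ∈ IsManifold.maximalAtlas (𝓡 3) ∞ M) {q : M}
    (hq : q ∈ e.source) : (mfderiv 𝓘(ℝ, R3) (𝓡 3) e.symm (e q)).IsInvertible :=
  ⟨((mdifferentiable_of_mem_maximalAtlas he).symm.mfderiv (e.map_source hq) :), rfl⟩

theorem inverse_mfderiv_symm (he : e ∈ IsManifold.maximalAtlas (𝓡 3) ∞ M) {q : M}
    (hq : q ∈ e.source) :
    (mfderiv 𝓘(ℝ, R3) (𝓡 3) e.symm (e q)).inverse = mfderiv (𝓡 3) 𝓘(ℝ, R3) e q := by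
  have h : mfderiv 𝓘(ℝ, R3) (𝓡 3) e.symm (e q) =
      (((mdifferentiable_of_mem_maximalAtlas he).mfderiv hq).symm :
        TangentSpace 𝓘(ℝ, R3) (e q) →L[ℝ] TangentSpace (𝓡 3) q) := rfl
  rw [h]
  exact ContinuousLinearMap.inverse_equiv
    ((mdifferentiable_of_mem_maximalAtlas he).mfderiv hq).symm

theorem coords_eq_mpullback (he : e ∈ IsManifold.maximalAtlas (𝓡 3) ∞ M) {q : M}
    (hq : q ∈ e.source) (Y : ∀ q : M, TangentSpace (𝓡 3) q) :
    coords e q (Y q) = VectorField.mpullback 𝓘(ℝ, R3) (𝓡 3) e.symm Y (e q) := by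
  have h : ∀ q', q' = q → (mfderiv (𝓡 3) 𝓘(ℝ, R3) e q : R3 →L[ℝ] R3) (Y q) =
      (mfderiv (𝓡 3) 𝓘(ℝ, R3) e q : R3 →L[ℝ] R3) (Y q') := by
    rintro q' rfl
    rfl
  rw [VectorField.mpullback_apply, inverse_mfderiv_symm he hq]
  exact h _ (e.left_inv hq)

theorem localF_apply' (F : TangentBundle (𝓡 3) M → ℝ) {p : M} (hp : p ∈ e.source)
    (y : R3) : localF F e (e p) y = F ⟨p, ofCoords e p y⟩ := by
  have : ∀ q, q = p → F ⟨q, ofCoords e q y⟩ = F ⟨p, ofCoords e p y⟩ := by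
    rintro q rfl
    rfl
  exact this _ (e.left_inv hp)

theorem localF_apply (F : TangentBundle (𝓡 3) M → ℝ)
    (he : e ∈ IsManifold.maximalAtlas (𝓡 3) ∞ M) {p : M} (hp : p ∈ e.source)
    (v : TangentSpace (𝓡 3) p) : localF F e (e p) (coords e p v) = F ⟨p, v⟩ := by
  have : ∀ q, q = p → F ⟨q, ofCoords e q (coords e p v)⟩ = F ⟨p, v⟩ := by
    rintro q rfl
    rw [ofCoords_coords he hp]
  exact this _ (e.left_inv hp)

theorem eq_sum_coordField (he : e ∈ IsManifold.maximalAtlas (𝓡 3) ∞ M) {p : M}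
    (hp : p ∈ e.source) (v : TangentSpace (𝓡 3) p) :
    v = ∑ j, coords e p v j • coordField e j p := by
  conv_lhs => rw [← ofCoords_coords he hp v, eq_sum_basisVec (coords e p v)]
  simp only [coordField, ← coordsEquiv_symm_apply he hp, map_sum, map_smul]

variable [IsManifold (𝓡 3) ∞ M]

/-- Vector fields with constant coordinates in a chart are smooth. -/
theorem contMDiffAt_ofCoords (he : e ∈ IsManifold.maximalAtlas (𝓡 3) ∞ M) {p : M}
    (hp : p ∈ e.source) (y : R3) :
    ContMDiffAt (𝓡 3) (𝓡 3).tangent ∞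
      (fun q => (⟨q, ofCoords e q y⟩ : TangentBundle (𝓡 3) M)) p := by
  have hV : ContMDiffAt 𝓘(ℝ, R3) 𝓘(ℝ, R3).tangent ∞
      (fun x => (⟨x, y⟩ : TangentBundle 𝓘(ℝ, R3) R3)) (e p) :=
    contMDiffAt_vectorSpace_iff_contDiffAt.2 contDiffAt_const
  exact ContMDiffAt.mpullback_vectorField_preimage (n := ∞) hV
    (contMDiffAt_of_mem_maximalAtlas he hp) (isInvertible_mfderiv he hp) (by simp)

theorem vfDiffAt_ofCoords (he : e ∈ IsManifold.maximalAtlas (𝓡 3) ∞ M) {p : M}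
    (hp : p ∈ e.source) (y : R3) : VFDiffAt (fun q => ofCoords e q y) p :=
  (contMDiffAt_ofCoords he hp y).mdifferentiableAt (by simp)

theorem vfDiffAt_coordField (he : e ∈ IsManifold.maximalAtlas (𝓡 3) ∞ M) {p : M}
    (hp : p ∈ e.source) (j : Fin 3) : VFDiffAt (coordField e j) p :=
  vfDiffAt_ofCoords he hp _

end Charts

section Fields

variable {M : Type*} [TopologicalSpace M] [ChartedSpace R3 M] [IsManifold (𝓡 3) ∞ M]
  {e : OpenPartialHomeomorph M R3}

/-- The coordinates of a smooth vector field are smooth functions. -/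
theorem contMDiffAt_coords (he : e ∈ IsManifold.maximalAtlas (𝓡 3) ∞ M) {p : M}
    (hp : p ∈ e.source) {Y : ∀ q : M, TangentSpace (𝓡 3) q}
    (hY : ContMDiffAt (𝓡 3) (𝓡 3).tangent ∞ (fun q => (⟨q, Y q⟩ : TangentBundle (𝓡 3) M)) p) :
    ContMDiffAt (𝓡 3) 𝓘(ℝ, R3) ∞ (fun q => coords e q (Y q)) p := by
  have hY' : ContMDiffAt (𝓡 3) (𝓡 3).tangent ∞
      (fun q => (⟨q, Y q⟩ : TangentBundle (𝓡 3) M)) (e.symm (e p)) := by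
    rwa [e.left_inv hp]
  have h1 := ContMDiffAt.mpullback_vectorField_preimage (n := ∞) hY'
    (contMDiffAt_symm_of_mem_maximalAtlas he (e.map_source hp))
    (isInvertible_mfderiv_symm he hp) (by simp)
  have h2 := (contMDiffAt_vectorSpace_iff_contDiffAt.1 h1).contMDiffAt
  have h3 := h2.comp p (contMDiffAt_of_mem_maximalAtlas he hp)
  refine h3.congr_of_eventuallyEq ?_
  filter_upwards [e.open_source.mem_nhds hp] with q hq
  exact coords_eq_mpullback he hq Y

theorem mdifferentiableAt_coords (he : e ∈ IsManifold.maximalAtlas (𝓡 3) ∞ M) {p : M}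
    (hp : p ∈ e.source) {Y : ∀ q : M, TangentSpace (𝓡 3) q} (hY : VFDiffAt Y p) :
    MDifferentiableAt (𝓡 3) 𝓘(ℝ, R3) (fun q => coords e q (Y q)) p := by
  have hY' : MDifferentiableAt (𝓡 3) (𝓡 3).tangent
      (fun q => (⟨q, Y q⟩ : TangentBundle (𝓡 3) M)) (e.symm (e p)) := by
    rw [e.left_inv hp]; exact hY
  have : IsManifold (𝓡 3) 2 M := IsManifold.of_le (n := ∞) (by norm_cast)
  have h1 := MDifferentiableAt.mpullback_vectorField (n := ∞) hY'
    (contMDiffAt_symm_of_mem_maximalAtlas he (e.map_source hp))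
    (isInvertible_mfderiv_symm he hp) (by norm_cast)
  have h2 := ((contMDiff_snd_tangentBundle_modelSpace R3 𝓘(ℝ, R3)
    (n := 1)).mdifferentiableAt (by simp)).comp (e p) h1
  have h3 := h2.comp p ((contMDiffAt_of_mem_maximalAtlas he hp).mdifferentiableAt (by simp))
  refine h3.congr_of_eventuallyEq ?_
  filter_upwards [e.open_source.mem_nhds hp] with q hq
  exact coords_eq_mpullback he hq Y

/-- The inclusion of a tangent space in the tangent bundle is smooth. -/
theorem contMDiff_mk_ofCoords (he : e ∈ IsManifold.maximalAtlas (𝓡 3) ∞ M) {p : M}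
    (hp : p ∈ e.source) :
    ContMDiff 𝓘(ℝ, R3) (𝓡 3).tangent ∞
      (fun y => (⟨p, ofCoords e p y⟩ : TangentBundle (𝓡 3) M)) := by
  intro y
  refine Bundle.contMDiffAt_totalSpace.2 ⟨contMDiffAt_const, ?_⟩
  have hmem : p ∈ (trivializationAt R3 (TangentSpace (𝓡 3)) p).baseSet :=
    FiberBundle.mem_baseSet_trivializationAt' p
  have : (fun y : R3 => (trivializationAt R3 (TangentSpace (𝓡 3)) p
      (⟨p, ofCoords e p y⟩ : TangentBundle (𝓡 3) M)).2) = fun y =>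
      ((trivializationAt R3 (TangentSpace (𝓡 3)) p).continuousLinearMapAt ℝ p).comp
        ((coordsEquiv he hp).symm : R3 →L[ℝ] TangentSpace (𝓡 3) p) y := by
    ext1 y
    rw [ContinuousLinearMap.comp_apply, Bundle.Trivialization.continuousLinearMapAt_apply,
      Bundle.Trivialization.coe_linearMapAt_of_mem _ hmem]
    congr 3
    exact (coordsEquiv_symm_apply he hp y).symm
  rw [this]
  exact (ContinuousLinearMap.contDiff _).contMDiff.contMDiffAt

theorem isMinkowski_localF {F : TangentBundle (𝓡 3) M → ℝ} (hF : IsFinslerMetric F)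
    (he : e ∈ IsManifold.maximalAtlas (𝓡 3) ∞ M) {x : R3} (hx : x ∈ e.target) :
    IsMinkowski (localF F e x) where
  nonneg y := hF.nonneg _
  homog t y ht := by
    have hp : e.symm x ∈ e.source := e.map_target hx
    have h : ofCoords e (e.symm x) (t • y) = t • ofCoords e (e.symm x) y := by
      simp only [← coordsEquiv_symm_apply he hp, map_smul]
    simp only [localF, h, hF.homogeneous _ _ _ ht]
  smooth y hy := by
    have hp : e.symm x ∈ e.source := e.map_target hx
    have h := hF.smooth.comp (s := ({0}ᶜ : Set R3)) (contMDiff_mk_ofCoords he hp).contMDiffOn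
      (fun y hy => by
        have hy : y ≠ 0 := hy
        simpa [← coordsEquiv_symm_apply he hp] using hy)
    exact (contMDiffOn_iff_contDiffOn.1 h).contDiffAt (isOpen_compl_singleton.mem_nhds hy)
  posDef y hy := hF.strongly_convex e he x hx y hy

/-- The value of the averaged metric may be computed in any chart. -/
theorem averagedMetric_eq {F : TangentBundle (𝓡 3) M → ℝ} (hF : IsFinslerMetric F)
    (he : e ∈ IsManifold.maximalAtlas (𝓡 3) ∞ M) {p : M} (hp : p ∈ e.source)
    (v w : TangentSpace (𝓡 3) p) :
    averagedMetric F p v w = formOf (gram F e (e p)) (coords e p v) (coords e p w) := by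
  have he' : chartAt R3 p ∈ IsManifold.maximalAtlas (𝓡 3) ∞ M :=
    IsManifold.chart_mem_maximalAtlas p
  have hp' : p ∈ (chartAt R3 p).source := mem_chart_source R3 p
  set A : R3 ≃L[ℝ] R3 := (coordsEquiv he' hp').symm.trans (coordsEquiv he hp) with hA
  have hloc : localF F (chartAt R3 p) (chartAt R3 p p) =
      fun y => localF F e (e p) (A y) := by
    ext y
    rw [localF_apply' F hp', ← localF_apply F he hp]
    simp only [hA, ContinuousLinearEquiv.trans_apply, coordsEquiv_apply, coordsEquiv_symm_apply]
  have hAc : ∀ v, A (coords (chartAt R3 p) p v) = coords e p v := by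
    intro v
    simp only [hA, ContinuousLinearEquiv.trans_apply, coordsEquiv_apply, coordsEquiv_symm_apply,
      ofCoords_coords he' hp']
  have h := (isMinkowski_localF hF he (e.map_source hp)).formOf_averagedGram_comp A
    (coords (chartAt R3 p) p v) (coords (chartAt R3 p) p w)
  rw [hAc, hAc, ← hloc] at h
  exact h

theorem gram_posDef {F : TangentBundle (𝓡 3) M → ℝ} (hF : IsFinslerMetric F)
    (he : e ∈ IsManifold.maximalAtlas (𝓡 3) ∞ M) {x : R3} (hx : x ∈ e.target) :
    (gram F e x).PosDef :=
  (isMinkowski_localF hF he hx).averagedGram_posDef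

end Fields

/-! ### Covariant derivatives in a chart -/

section Connections

variable {M : Type*} [TopologicalSpace M] [ChartedSpace R3 M] [IsManifold (𝓡 3) ∞ M]
  {e : OpenPartialHomeomorph M R3}

/-- The bilinear map `(u, y) ↦ u^i y^j Γ_{ij}^k e_k` of connection coefficients in a chart. -/
def christoffel (nabla : LinearConnection M) (e : OpenPartialHomeomorph M R3) (p : M) :
    R3 →L[ℝ] R3 →L[ℝ] R3 :=
  ∑ i : Fin 3, ∑ j : Fin 3, (EuclideanSpace.proj (𝕜 := ℝ) i).smulRight
    ((EuclideanSpace.proj (𝕜 := ℝ) j).smulRight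
      (coords e p (nabla (coordField e j) p (coordField e i p))))

theorem christoffel_apply (nabla : LinearConnection M) (e : OpenPartialHomeomorph M R3) (p : M)
    (u y : R3) : christoffel nabla e p u y =
      ∑ i : Fin 3, ∑ j : Fin 3,
        (u i * y j) • coords e p (nabla (coordField e j) p (coordField e i p)) := by
  simp [christoffel, smul_smul, Fin.sum_univ_three]

theorem christoffel_apply_coord (nabla : LinearConnection M) (e : OpenPartialHomeomorph M R3)
    (p : M) (u y : R3) (k : Fin 3) : christoffel nabla e p u y k =
      ∑ i : Fin 3, ∑ j : Fin 3, u i * y j * connCoeff nabla e i j k p := by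
  simp [christoffel_apply, connCoeff, Fin.sum_univ_three]

/-- The coordinate expression `∇_v Y = (v(Y^k) + v^i Y^j Γ_{ij}^k) ∂/∂u^k`. -/
theorem coords_nabla (nabla : LinearConnection M) (he : e ∈ IsManifold.maximalAtlas (𝓡 3) ∞ M)
    {p : M} (hp : p ∈ e.source) {Y : ∀ q : M, TangentSpace (𝓡 3) q} (hY : VFDiffAt Y p)
    (v : TangentSpace (𝓡 3) p) :
    coords e p (nabla Y p v) =
      mvfderiv (𝓡 3) (fun q => coords e q (Y q)) p v +
        christoffel nabla e p (coords e p v) (coords e p (Y p)) := by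
  have hc := mdifferentiableAt_coords he hp hY
  set X : Fin 3 → ∀ q : M, TangentSpace (𝓡 3) q := coordField e with hX
  have hXd : ∀ j, VFDiffAt (X j) p := fun j => vfDiffAt_coordField he hp j
  set g : Fin 3 → M → ℝ := fun j q => coords e q (Y q) j with hg
  have hgd : ∀ j, HasMFDerivAt (𝓡 3) 𝓘(ℝ, ℝ) (g j) p
      ((EuclideanSpace.proj (𝕜 := ℝ) j : R3 →L[ℝ] ℝ).comp
        (mfderiv (𝓡 3) 𝓘(ℝ, R3) (fun q => coords e q (Y q)) p)) := fun j =>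
    HasMFDerivAt.comp p
      ((EuclideanSpace.proj (𝕜 := ℝ) j : R3 →L[ℝ] ℝ).hasMFDerivAt) hc.hasMFDerivAt
  have hgX : ∀ j, VFDiffAt (g j • X j) p := fun j =>
    (hgd j).mdifferentiableAt.smul_section (hXd j)
  have hsum : ∀ q ∈ e.source, Y q = (g 0 • X 0 + g 1 • X 1 + g 2 • X 2) q := by
    intro q hq
    conv_lhs => rw [eq_sum_coordField he hq (Y q), Fin.sum_univ_three]
    rfl
  have h01 : VFDiffAt (g 0 • X 0 + g 1 • X 1) p := mdifferentiableAt_add_section (hgX 0) (hgX 1)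
  have h012 : VFDiffAt (g 0 • X 0 + g 1 • X 1 + g 2 • X 2) p := 
    mdifferentiableAt_add_section h01 (hgX 2)
  have hcov := nabla.isCovariantDerivativeOnUniv
  have h1 : nabla Y p = nabla (g 0 • X 0 + g 1 • X 1 + g 2 • X 2) p :=
    (nabla.isCovariantDerivativeOn (s := e.source)).congr_of_eqOn hY h012
      (e.open_source.mem_nhds hp) hsum
  have hl : ∀ j, nabla (g j • X j) p = g j p • nabla (X j) p +
      (mvfderiv (𝓡 3) (g j) p).smulRight (X j p) :=
    fun j => hcov.leibniz (hXd j) (hgd j).mdifferentiableAt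
  have hm : ∀ j, mvfderiv (𝓡 3) (g j) p v =
      mvfderiv (𝓡 3) (fun q => coords e q (Y q)) p v j := by
    intro j
    simp only [mvfderiv, (hgd j).mfderiv]
    rfl
  rw [h1, hcov.add h01 (hgX 2), hcov.add (hgX 0) (hgX 1), hl, hl, hl]
  have hXv : ∀ j, nabla (X j) p v = ∑ i, coords e p v i • nabla (X j) p (X i p) := by
    intro j
    conv_lhs => rw [eq_sum_coordField he hp v]
    simp only [map_sum, map_smul, hX]
  simp only [_root_.add_apply, _root_.smul_apply, ContinuousLinearMap.smulRight_apply, hm, hXv]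
  simp only [← coordsEquiv_apply he hp, map_add, map_smul, map_sum]
  have hXc : ∀ j, coordsEquiv he hp (X j p) = basisVec j := fun j => coords_ofCoords he hp _
  conv_rhs => rw [eq_sum_basisVec (mvfderiv (𝓡 3) (fun q => coords e q (Y q)) p v)]
  simp only [hXc, christoffel_apply, Fin.sum_univ_three, hg, ← coordsEquiv_apply he hp, ← hX]
  module

/-- The connection coefficients of a smooth connection are continuous. -/
theorem continuousAt_christoffel [T2Space M] {nabla : LinearConnection M}
    (hsmooth : CovariantDerivative.ContMDiffCovariantDerivative nabla ∞)
    (he : e ∈ IsManifold.maximalAtlas (𝓡 3) ∞ M) {p : M} (hp : p ∈ e.source) :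
    ContinuousAt (christoffel nabla e) p := by
  have key : ∀ i j, ContinuousAt
      (fun q => coords e q (nabla (coordField e j) q (coordField e i q))) p := by
    intro i j
    -- smoothness of the connection concerns globally smooth fields: cut the coordinate field off
    obtain ⟨f, -, hf⟩ := (SmoothBumpFunction.nhds_basis_tsupport (I := 𝓡 3) p).mem_iff.1
      (e.open_source.mem_nhds hp)
    have hσ : ContMDiff (𝓡 3) (𝓡 3).tangent ∞
        (fun q => (⟨q, ((f : M → ℝ) • coordField e j) q⟩ : TangentBundle (𝓡 3) M)) :=
      ContMDiffOn.smul_section_of_tsupport f.contMDiff.contMDiffOn e.open_source hf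
        fun q hq => (contMDiffAt_ofCoords he hq _).contMDiffWithinAt
    have h1 := hsmooth.contMDiff.contMDiff (σ := (f : M → ℝ) • coordField e j)
      (by simpa using hσ.contMDiffOn)
    have h2 := (h1.contMDiffAt Filter.univ_mem (x := p)).clm_bundle_apply
      (contMDiffAt_ofCoords he hp (basisVec i))
    have h3 := (contMDiffAt_coords he hp h2).continuousAt
    refine h3.congr ?_
    filter_upwards [f.eventuallyEq_one.eventually_nhds, e.open_source.mem_nhds hp] with q hq hqe
    have h4 : nabla ((f : M → ℝ) • coordField e j) q = nabla (coordField e j) q := by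
      refine (nabla.isCovariantDerivativeOn (s := univ)).congr_of_eventuallyEq
        (hσ.mdifferentiable (by simp) q) (vfDiffAt_coordField he hqe j) Filter.univ_mem ?_
      filter_upwards [hq] with q' hq'
      simp [hq']
    rw [h4]
    rfl
  have : ContinuousAdd (R3 →L[ℝ] R3 →L[ℝ] R3) := by
    have h : IsTopologicalAddGroup (R3 →L[ℝ] R3 →L[ℝ] R3) := inferInstance
    exact @IsTopologicalAddGroup.toContinuousAdd _ _ _ h
  unfold christoffel
  refine tendsto_finsetSum _ fun i _ => tendsto_finsetSum _ fun j _ => ?_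
  have h1 : Continuous fun w : R3 => (EuclideanSpace.proj (𝕜 := ℝ) i).smulRight
      ((EuclideanSpace.proj (𝕜 := ℝ) j).smulRight w : R3 →L[ℝ] R3) :=
    ((ContinuousLinearMap.smulRightL ℝ R3 (R3 →L[ℝ] R3) (EuclideanSpace.proj i)).continuous).comp
      (ContinuousLinearMap.smulRightL ℝ R3 R3 (EuclideanSpace.proj j)).continuous
  exact ContinuousAt.comp (f := fun q => coords e q (nabla (coordField e j) q (coordField e i q)))
    h1.continuousAt (key i j)

end Connections

/-! ### Parallel transport along short segments -/

section Transport

variable {E V : Type*} [NormedAddCommGroup E] [NormedSpace ℝ E] [NormedAddCommGroup V]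
  [NormedSpace ℝ V]

/-- A linear differential equation `U' = -A(t) U` on `[0, 1]` with small coefficients has a
fundamental solution. -/
theorem exists_fundamental_solution [CompleteSpace V] {A : ℝ → V →L[ℝ] V}
    (hA : ContinuousOn A (Icc 0 1)) (hb : ∀ t ∈ Icc (0 : ℝ) 1, ‖A t‖ ≤ 1 / 2) :
    ∃ U : ℝ → V →L[ℝ] V, U 0 = 1 ∧
      ∀ t ∈ Icc (0 : ℝ) 1, HasDerivWithinAt U (-(A t ∘L U t)) (Icc 0 1) t := by
  have hPL : IsPicardLindelof (fun t (U : V →L[ℝ] V) => -(A t ∘L U))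
      (⟨0, by simp⟩ : Icc (0 : ℝ) 1) (1 : V →L[ℝ] V) 1 0 1 (1 / 2) := by
    refine ⟨fun t ht => ?_, fun U _ => ?_, fun t ht U hU => ?_, by simp⟩
    · refine LipschitzOnWith.of_dist_le_mul fun U _ W _ => ?_
      rw [dist_eq_norm, dist_eq_norm]
      have : -(A t ∘L U) - -(A t ∘L W) = -(A t ∘L (U - W)) := by
        rw [ContinuousLinearMap.comp_sub]; abel
      rw [this, norm_neg]
      refine (ContinuousLinearMap.opNorm_comp_le _ _).trans ?_
      have := hb t ht
      simp only [NNReal.coe_div, NNReal.coe_one, NNReal.coe_ofNat]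
      gcongr
    · exact (hA.clm_comp continuousOn_const).neg
    · rw [norm_neg]
      have h1 : ‖U‖ ≤ 2 := by
        have h2 : ‖U - 1‖ ≤ 1 := by simpa [dist_eq_norm] using hU
        have h3 : ‖(1 : V →L[ℝ] V)‖ ≤ 1 := ContinuousLinearMap.norm_id_le
        calc ‖U‖ = ‖(U - 1) + 1‖ := by rw [sub_add_cancel]
          _ ≤ ‖U - 1‖ + ‖(1 : V →L[ℝ] V)‖ := norm_add_le _ _
          _ ≤ 2 := by linarith
      calc ‖A t ∘L U‖ ≤ ‖A t‖ * ‖U‖ := ContinuousLinearMap.opNorm_comp_le _ _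
        _ ≤ 1 / 2 * 2 := by
          have := hb t ht
          gcongr
        _ = ((1 : NNReal) : ℝ) := by norm_num
  obtain ⟨U, hU0, hU⟩ := hPL.exists_eq_forall_mem_Icc_hasDerivWithinAt₀
  exact ⟨U, hU0, hU⟩

/-- The mean value inequality, applied with the maximum of `‖U‖`, bounds that maximum by `1` plus
half of itself. -/
theorem norm_fundamental_solution_le {A : ℝ → V →L[ℝ] V} {U : ℝ → V →L[ℝ] V} (hU0 : U 0 = 1)
    (hU : ∀ t ∈ Icc (0 : ℝ) 1, HasDerivWithinAt U (-(A t ∘L U t)) (Icc 0 1) t) {a : ℝ}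
    (ha : a ≤ 1 / 2) (hb : ∀ t ∈ Icc (0 : ℝ) 1, ‖A t‖ ≤ a) :
    ∀ t ∈ Icc (0 : ℝ) 1, ‖U t‖ ≤ 2 ∧ ‖U t - 1‖ ≤ 2 * a := by
  have ha0 : 0 ≤ a := (norm_nonneg _).trans (hb 0 (by simp))
  have hc : ContinuousOn U (Icc 0 1) := fun t ht => (hU t ht).continuousWithinAt
  obtain ⟨s, hs, hmax⟩ := isCompact_Icc.exists_isMaxOn (by simp : (Icc (0 : ℝ) 1).Nonempty) hc.norm
  have hmax : ∀ t ∈ Icc (0 : ℝ) 1, ‖U t‖ ≤ ‖U s‖ := fun t ht => hmax ht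
  have hdiff : ∀ t ∈ Icc (0 : ℝ) 1, ‖U t - 1‖ ≤ a * ‖U s‖ := by
    intro t ht
    have h1 := Convex.norm_image_sub_le_of_norm_hasDerivWithin_le (C := a * ‖U s‖) hU
      (fun t ht => by
        rw [norm_neg]
        refine (ContinuousLinearMap.opNorm_comp_le _ _).trans ?_
        have h1 := hb t ht
        have h2 := hmax t ht
        gcongr) (convex_Icc 0 1) (by simp : (0 : ℝ) ∈ Icc (0 : ℝ) 1) ht
    rw [hU0] at h1
    refine h1.trans ?_
    rw [sub_zero, Real.norm_of_nonneg ht.1]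
    exact mul_le_of_le_one_right (by positivity) ht.2
  have h2 : ‖U s‖ ≤ 2 := by
    have h3 : ‖(1 : V →L[ℝ] V)‖ ≤ 1 := ContinuousLinearMap.norm_id_le
    have h4 : ‖U s‖ ≤ ‖U s - 1‖ + ‖(1 : V →L[ℝ] V)‖ := by
      simpa using norm_add_le (U s - 1) 1
    have h5 := hdiff s hs
    nlinarith [norm_nonneg (U s)]
  intro t ht
  refine ⟨(hmax t ht).trans h2, (hdiff t ht).trans ?_⟩
  rw [mul_comm]
  gcongr

/-- Parallel transport along the segment from `x₀` to `x`, as a function of `x`: its derivative at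
`x₀` is minus the connection form `Γ x₀`. -/
theorem exists_transport [CompleteSpace V] {Γ : E → E →L[ℝ] V →L[ℝ] V} {x₀ : E}
    (hΓ : ∀ᶠ x in nhds x₀, ContinuousAt Γ x) :
    ∃ P : E → V →L[ℝ] V, P x₀ = 1 ∧ HasFDerivAt P (-Γ x₀) x₀ ∧
      ∀ᶠ x in nhds x₀, ∃ U : ℝ → V →L[ℝ] V, U 0 = 1 ∧ U 1 = P x ∧
        ∀ t ∈ Icc (0 : ℝ) 1,
          HasDerivWithinAt U (-(Γ (x₀ + t • (x - x₀)) (x - x₀) ∘L U t)) (Icc 0 1) t := by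
  set C : ℝ := ‖Γ x₀‖ + 1 with hC
  have hC0 : 0 < C := by positivity
  have hcont : ∀ ε > 0, ∀ᶠ x in nhds x₀, ‖Γ x - Γ x₀‖ < ε := by
    intro ε hε
    have := (Metric.continuousAt_iff' (α := E →L[ℝ] V →L[ℝ] V)).1 hΓ.self_of_nhds ε hε
    exact this.mono fun x hx => (dist_eq_norm (Γ x) (Γ x₀)).symm.trans_lt hx
  have hbd : ∀ᶠ x in nhds x₀, ‖Γ x‖ < C := by
    filter_upwards [hcont 1 one_pos] with x hx
    have := norm_add_le (Γ x - Γ x₀) (Γ x₀)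
    rw [sub_add_cancel] at this
    linarith
  obtain ⟨r₀, hr₀, hball⟩ := Metric.eventually_nhds_iff_ball.1 (hΓ.and hbd)
  -- on the ball of radius `r` the equation has coefficients of norm at most `1 / 2`
  set r : ℝ := min r₀ (1 / (2 * C)) with hr
  have hr0 : 0 < r := lt_min hr₀ (by positivity)
  have hseg : ∀ {x : E} {δ : ℝ}, x ∈ Metric.ball x₀ δ → ∀ t ∈ Icc (0 : ℝ) 1,
      x₀ + t • (x - x₀) ∈ Metric.ball x₀ δ := by
    intro x δ hx t ht
    rw [mem_ball_iff_norm] at hx ⊢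
    rw [add_sub_cancel_left, norm_smul, Real.norm_of_nonneg ht.1]
    exact (mul_le_of_le_one_left (norm_nonneg _) ht.2).trans_lt hx
  have hA : ∀ x ∈ Metric.ball x₀ r, ∀ t ∈ Icc (0 : ℝ) 1,
      ‖Γ (x₀ + t • (x - x₀)) (x - x₀)‖ ≤ C * ‖x - x₀‖ := by
    intro x hx t ht
    refine ((Γ _).le_opNorm _).trans ?_
    have := (hball _ (Metric.ball_subset_ball (min_le_left _ _) (hseg hx t ht))).2.le
    gcongr
  have hsmall : ∀ x ∈ Metric.ball x₀ r, C * ‖x - x₀‖ ≤ 1 / 2 := by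
    intro x hx
    rw [mem_ball_iff_norm] at hx
    have h1 : ‖x - x₀‖ ≤ 1 / (2 * C) := hx.le.trans (min_le_right _ _)
    calc C * ‖x - x₀‖ ≤ C * (1 / (2 * C)) := by gcongr
      _ = 1 / 2 := by field_simp
  have hex : ∀ x ∈ Metric.ball x₀ r, ∃ U : ℝ → V →L[ℝ] V, U 0 = 1 ∧
      ∀ t ∈ Icc (0 : ℝ) 1,
        HasDerivWithinAt U (-(Γ (x₀ + t • (x - x₀)) (x - x₀) ∘L U t)) (Icc 0 1) t := by
    intro x hx
    refine exists_fundamental_solution (fun t ht => ?_)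
      fun t ht => (hA x hx t ht).trans (hsmall x hx)
    have h1 := (hball _ (Metric.ball_subset_ball (min_le_left _ _) (hseg hx t ht))).1
    have h2 : ContinuousAt (fun t : ℝ => x₀ + t • (x - x₀)) t := by fun_prop
    exact ((ContinuousAt.comp (f := fun t : ℝ => x₀ + t • (x - x₀)) h1 h2).clm_apply
      continuousAt_const).continuousWithinAt
  choose! W hW0 hW using hex
  have hest : ∀ ε > 0, ∀ᶠ x in nhds x₀, ‖W x 1 - 1 + Γ x₀ (x - x₀)‖ ≤ ε * ‖x - x₀‖ := by
    intro ε hε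
    obtain ⟨δ, hδ, hball'⟩ :=
      Metric.eventually_nhds_iff_ball.1 (hcont (ε / 4) (by positivity))
    filter_upwards [Metric.ball_mem_nhds x₀ hr0, Metric.ball_mem_nhds x₀ hδ,
      Metric.ball_mem_nhds x₀ (show 0 < ε / (4 * C ^ 2) by positivity)] with x hx hxδ hxε
    set h := x - x₀ with hh
    have hxε : ‖h‖ ≤ ε / (4 * C ^ 2) := by
      rw [mem_ball_iff_norm] at hxε
      exact hxε.le
    have hbounds := norm_fundamental_solution_le (hW0 x hx) (hW x hx) (hsmall x hx) (hA x hx)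
    have hΓ0 : ‖Γ x₀ h‖ ≤ C * ‖h‖ := by
      refine ((Γ x₀).le_opNorm h).trans ?_
      gcongr
      linarith
    -- `W x t + t Γ(x₀) h` has derivative `-(Γ(x₀ + t h) - Γ(x₀)) h W - Γ(x₀) h (W - 1) = o(‖h‖)`
    have hder : ∀ t ∈ Icc (0 : ℝ) 1, HasDerivWithinAt (fun t => W x t + t • Γ x₀ h)
        (-(Γ (x₀ + t • h) h ∘L W x t) + Γ x₀ h) (Icc 0 1) t := by
      intro t ht
      have := (hW x hx t ht).add ((hasDerivWithinAt_id t (Icc (0 : ℝ) 1)).smul_const (Γ x₀ h))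
      rwa [one_smul] at this
    have hle := Convex.norm_image_sub_le_of_norm_hasDerivWithin_le (C := ε * ‖h‖) hder
      (fun t ht => by
        obtain ⟨hb1, hb2⟩ := hbounds t ht
        have hΓt : ‖Γ (x₀ + t • h) h - Γ x₀ h‖ ≤ ε / 4 * ‖h‖ := by
          have h1 := (hball' _ (hseg hxδ t ht)).le
          have h2 := (Γ (x₀ + t • h) - Γ x₀).le_opNorm h
          rw [_root_.sub_apply] at h2
          exact h2.trans (by gcongr)
        have heq : -(Γ (x₀ + t • h) h ∘L W x t) + Γ x₀ h =
            -((Γ (x₀ + t • h) h - Γ x₀ h) ∘L W x t) - Γ x₀ h ∘L (W x t - 1) := by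
          rw [ContinuousLinearMap.sub_comp, ContinuousLinearMap.comp_sub]
          have : Γ x₀ h ∘L (1 : V →L[ℝ] V) = Γ x₀ h := ContinuousLinearMap.comp_id _
          rw [this]
          abel
        rw [heq]
        have h1 : ‖(Γ (x₀ + t • h) h - Γ x₀ h) ∘L W x t‖ ≤ ε / 4 * ‖h‖ * 2 :=
          (ContinuousLinearMap.opNorm_comp_le _ _).trans (by gcongr)
        have h2 : ‖Γ x₀ h ∘L (W x t - 1)‖ ≤ C * ‖h‖ * (2 * (C * ‖h‖)) :=
          (ContinuousLinearMap.opNorm_comp_le _ _).trans (by gcongr)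
        have h3 : C * ‖h‖ * (2 * (C * ‖h‖)) ≤ ε / 2 * ‖h‖ := by
          have h4 : ‖h‖ * (4 * C ^ 2) ≤ ε := (le_div_iff₀ (by positivity)).1 hxε
          nlinarith [norm_nonneg h]
        calc _ ≤ ‖-((Γ (x₀ + t • h) h - Γ x₀ h) ∘L W x t)‖ + ‖Γ x₀ h ∘L (W x t - 1)‖ :=
              norm_sub_le _ _
          _ ≤ ε * ‖h‖ := by rw [norm_neg]; linarith)
      (convex_Icc 0 1) (by simp : (0 : ℝ) ∈ Icc (0 : ℝ) 1) (by simp : (1 : ℝ) ∈ Icc (0 : ℝ) 1)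
    simp only [hW0 x hx, one_smul, zero_smul, add_zero, sub_zero, norm_one, mul_one] at hle
    rwa [add_sub_right_comm] at hle
  have hP0 : W x₀ 1 = 1 := by
    have := (hest 1 one_pos).self_of_nhds
    simp only [sub_self, map_zero, add_zero, norm_zero, mul_zero, norm_le_zero_iff] at this
    exact sub_eq_zero.1 this
  refine ⟨fun x => W x 1, hP0, ?_, ?_⟩
  · refine HasFDerivAt.of_isLittleO (Asymptotics.isLittleO_iff.2 fun ε hε => ?_)
    filter_upwards [hest ε hε] with x hx
    rw [hP0]
    simpa [sub_eq_add_neg] using hx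
  · filter_upwards [Metric.ball_mem_nhds x₀ hr0] with x hx
    exact ⟨W x, hW0 x hx, rfl, hW x hx⟩

end Transport

/-! ### Connections preserving the Finsler function -/

/-- The derivative of inversion of operators at the identity is minus the identity. -/
theorem hasFDerivAt_ringInverse_of_eq_one {E V : Type*} [NormedAddCommGroup E] [NormedSpace ℝ E]
    [NormedAddCommGroup V] [NormedSpace ℝ V] [CompleteSpace V] {P : E → V →L[ℝ] V}
    {P' : E →L[ℝ] V →L[ℝ] V} {x₀ : E} (h : P x₀ = 1) (hP : HasFDerivAt P P' x₀) :
    HasFDerivAt (fun x => Ring.inverse (P x)) (-P') x₀ := by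
  have h1 : HasFDerivAt Ring.inverse
      (-ContinuousLinearMap.mulLeftRight ℝ (V →L[ℝ] V) ↑(1 : (V →L[ℝ] V)ˣ)⁻¹
        ↑(1 : (V →L[ℝ] V)ˣ)⁻¹) (P x₀) := by
    rw [h]
    exact hasFDerivAt_ringInverse (1 : (V →L[ℝ] V)ˣ)
  refine (h1.comp x₀ hP).congr_fderiv ?_
  ext v w
  simp

section Compatible

variable {M : Type*} [TopologicalSpace M] [ChartedSpace R3 M] [IsManifold (𝓡 3) ∞ M]
  {e : OpenPartialHomeomorph M R3} {F : TangentBundle (𝓡 3) M → ℝ} {nabla : LinearConnection M}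

/-- A solution of the equation of parallel transport along a segment preserves the Finsler
function. -/
theorem IsCompatible.localF_eq (hcompat : IsCompatible F nabla)
    (he : e ∈ IsManifold.maximalAtlas (𝓡 3) ∞ M) {x₀ x : R3}
    (hseg : ∀ t ∈ Icc (0 : ℝ) 1, x₀ + t • (x - x₀) ∈ e.target) {U : ℝ → R3 →L[ℝ] R3}
    (hU0 : U 0 = 1)
    (hU : ∀ t ∈ Icc (0 : ℝ) 1, HasDerivWithinAt U
      (-(christoffel nabla e (e.symm (x₀ + t • (x - x₀))) (x - x₀) ∘L U t)) (Icc 0 1) t)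
    (y : R3) : localF F e x (U 1 y) = localF F e x₀ y := by
  set c : ℝ → M := fun t => e.symm (x₀ + t • (x - x₀)) with hc
  have hcs : ∀ t ∈ Icc (0 : ℝ) 1, c t ∈ e.source := fun t ht => e.map_target (hseg t ht)
  have hec : ∀ t ∈ Icc (0 : ℝ) 1, e (c t) = x₀ + t • (x - x₀) := fun t ht =>
    e.right_inv (hseg t ht)
  have hline : ContDiff ℝ ∞ fun t : ℝ => x₀ + t • (x - x₀) := by fun_prop
  have hcsm : ContMDiffOn 𝓘(ℝ, ℝ) (𝓡 3) ∞ c (Icc (0 : ℝ) 1) :=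
    (contMDiffOn_symm_of_mem_maximalAtlas he).comp hline.contMDiff.contMDiffOn hseg
  have hder : ∀ t ∈ Icc (0 : ℝ) 1, ∀ i,
      derivWithin (fun s => e (c s) i) (Icc (0 : ℝ) 1) t = (x - x₀) i := by
    intro t ht i
    have h1 : HasDerivWithinAt (fun s : ℝ => x₀ i + s * (x - x₀) i) ((x - x₀) i)
        (Icc (0 : ℝ) 1) t := by
      simpa using (((hasDerivAt_id t).mul_const ((x - x₀) i)).const_add (x₀ i)).hasDerivWithinAt
    have h2 : HasDerivWithinAt (fun s => e (c s) i) ((x - x₀) i) (Icc (0 : ℝ) 1) t :=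
      h1.congr (fun s hs => by rw [hec s hs]; simp) (by rw [hec t ht]; simp)
    exact h2.derivWithin (uniqueDiffOn_Icc zero_lt_one t ht)
  have hpar : IsParallel nabla c fun t => ofCoords e (c t) (U t y) := by
    intro t ht
    refine ⟨e, he, hcs t ht, fun k => ?_⟩
    have h1 : HasDerivWithinAt (fun s => U s y)
        (-(christoffel nabla e (c t) (x - x₀) (U t y))) (Icc 0 1) t := by
      simpa using (hU t ht).clm_apply (hasDerivWithinAt_const t (Icc (0 : ℝ) 1) y)
    have h2 : HasDerivWithinAt (fun s => U s y k)
        (-(christoffel nabla e (c t) (x - x₀) (U t y) k)) (Icc 0 1) t :=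
      (EuclideanSpace.proj (𝕜 := ℝ) k : R3 →L[ℝ] ℝ).hasFDerivAt.comp_hasDerivWithinAt t h1
    have h3 : HasDerivWithinAt (fun s => coords e (c s) (ofCoords e (c s) (U s y)) k)
        (-(christoffel nabla e (c t) (x - x₀) (U t y) k)) (Icc 0 1) t :=
      h2.congr (fun s hs => by rw [coords_ofCoords he (hcs s hs)])
        (by rw [coords_ofCoords he (hcs t ht)])
    convert! h3 using 2
    rw [christoffel_apply_coord, coords_ofCoords he (hcs t ht)]
    simp only [hder t ht]
  have h := hcompat c hcsm _ hpar 1 (by simp)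
  have h1 : ∀ q z, q = e.symm x → F ⟨q, ofCoords e q z⟩ = localF F e x z := by
    rintro _ z rfl
    rfl
  have h0 : ∀ q z, q = e.symm x₀ → F ⟨q, ofCoords e q z⟩ = localF F e x₀ z := by
    rintro _ z rfl
    rfl
  rw [h1 (c 1) _ (by simp [hc]), h0 (c 0) _ (by simp [hc]), hU0] at h
  exact h

/-- Near every point of a chart the Finsler function is obtained from its restriction to one
tangent space by linear isomorphisms `Q x`, the inverse parallel transports, whose derivative is
given by the connection coefficients. -/
theorem IsCompatible.exists_local_isometry [T2Space M] (hcompat : IsCompatible F nabla)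
    (hsmooth : CovariantDerivative.ContMDiffCovariantDerivative nabla ∞)
    (he : e ∈ IsManifold.maximalAtlas (𝓡 3) ∞ M) {x₀ : R3} (hx₀ : x₀ ∈ e.target) :
    ∃ Q : R3 → R3 →L[ℝ] R3, Q x₀ = 1 ∧
      HasFDerivAt Q (christoffel nabla e (e.symm x₀)) x₀ ∧
      ∀ᶠ x in nhds x₀, ∃ A : R3 ≃L[ℝ] R3, (A : R3 →L[ℝ] R3) = Q x ∧
        localF F e x = fun y => localF F e x₀ (A y) := by
  have hcont : ∀ᶠ x in nhds x₀, ContinuousAt (fun x => christoffel nabla e (e.symm x)) x := by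
    filter_upwards [e.open_target.mem_nhds hx₀] with x hx
    exact ContinuousAt.comp (f := e.symm)
      (continuousAt_christoffel hsmooth he (e.map_target hx)) (e.continuousAt_symm hx)
  obtain ⟨P, hP0, hPd, hP⟩ := exists_transport hcont
  have hunit : ∀ᶠ x in nhds x₀, IsUnit (P x) := by
    have h1 : {L : R3 →L[ℝ] R3 | IsUnit L} ∈ nhds (P x₀) :=
      Units.isOpen.mem_nhds (by rw [hP0]; exact isUnit_one)
    exact hPd.continuousAt.preimage_mem_nhds h1
  refine ⟨fun x => Ring.inverse (P x), by simp [hP0], ?_, ?_⟩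
  · simpa using hasFDerivAt_ringInverse_of_eq_one hP0 hPd
  · obtain ⟨δ, hδ, hball⟩ := Metric.mem_nhds_iff.1 (e.open_target.mem_nhds hx₀)
    filter_upwards [hP, hunit, Metric.ball_mem_nhds x₀ hδ] with x hx hu hxδ
    obtain ⟨U, hU0, hU1, hU⟩ := hx
    obtain ⟨u, hu⟩ := hu
    have hseg : ∀ t ∈ Icc (0 : ℝ) 1, x₀ + t • (x - x₀) ∈ e.target := by
      intro t ht
      apply hball
      rw [mem_ball_iff_norm] at hxδ ⊢
      rw [add_sub_cancel_left, norm_smul, Real.norm_of_nonneg ht.1]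
      exact (mul_le_of_le_one_left (norm_nonneg _) ht.2).trans_lt hxδ
    have hiso := hcompat.localF_eq he hseg hU0 hU
    refine ⟨ContinuousLinearEquiv.unitsEquiv ℝ R3 u⁻¹, ?_, ?_⟩
    · rw [← hu, Ring.inverse_unit]
      rfl
    · ext y
      rw [← hiso, hU1, ← hu]
      have h1 : (u : R3 →L[ℝ] R3) ((↑u⁻¹ : R3 →L[ℝ] R3) y) = y := by
        rw [← mul_apply_eq_comp, u.mul_inv]
        rfl
      exact congrArg (localF F e x) h1.symm

/-- `X_i^h E` as a derivative along the base minus a vertical derivative. -/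
theorem horizontalE_eq (F : TangentBundle (𝓡 3) M → ℝ) (nabla : LinearConnection M)
    (e : OpenPartialHomeomorph M R3) (i : Fin 3) (x y : R3) :
    horizontalE F nabla e i x y =
      fderiv ℝ (fun x' => energy (localF F e x') y) x (basisVec i) -
        fderiv ℝ (energy (localF F e x)) y
          (christoffel nabla e (e.symm x) (basisVec i) y) := by
  rw [horizontalE]
  congr 1
  conv_rhs => rw [eq_sum_basisVec (christoffel nabla e (e.symm x) (basisVec i) y)]
  simp only [map_sum, map_smul, christoffel_apply_coord, smul_eq_mul, Finset.sum_mul]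
  rw [Finset.sum_comm]
  refine Finset.sum_congr rfl fun l _ => ?_
  fin_cases i <;> simp [Fin.sum_univ_three]

/-- The horizontal lifts of a compatible connection annihilate the energy. -/
theorem IsCompatible.horizontalE_eq_zero [T2Space M] (hF : IsFinslerMetric F)
    (hcompat : IsCompatible F nabla)
    (hsmooth : CovariantDerivative.ContMDiffCovariantDerivative nabla ∞)
    (he : e ∈ IsManifold.maximalAtlas (𝓡 3) ∞ M) {x : R3} (hx : x ∈ e.target) (i : Fin 3)
    {y : R3} (hy : y ≠ 0) : horizontalE F nabla e i x y = 0 := by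
  obtain ⟨Q, hQ0, hQd, hQ⟩ := hcompat.exists_local_isometry hsmooth he hx
  have h1 : HasFDerivAt (fun x' => Q x' y) ((christoffel nabla e (e.symm x)).flip y) x := by
    simpa using hQd.clm_apply (hasFDerivAt_const y x)
  have h2 : HasFDerivAt (energy (localF F e x)) (fderiv ℝ (energy (localF F e x)) y) (Q x y) := by
    rw [hQ0]
    exact ((isMinkowski_localF hF he hx).energy_differentiableAt hy).hasFDerivAt
  have h3 : HasFDerivAt (fun x' => energy (localF F e x') y)
      ((fderiv ℝ (energy (localF F e x)) y).comp ((christoffel nabla e (e.symm x)).flip y)) x := by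
    refine (h2.comp x h1).congr_of_eventuallyEq ?_
    filter_upwards [hQ] with x' hx'
    obtain ⟨A, hA, hx'⟩ := hx'
    simp only [Function.comp_apply, ← hA, hx', energy]
    rfl
  rw [horizontalE_eq, h3.fderiv]
  simp

/-- A compatible connection is a metric connection of the averaged metric. -/
theorem IsCompatible.averagedMetric_deriv [T2Space M] (hF : IsFinslerMetric F)
    (hcompat : IsCompatible F nabla)
    (hsmooth : CovariantDerivative.ContMDiffCovariantDerivative nabla ∞)
    {p : M} {Y Z : ∀ q : M, TangentSpace (𝓡 3) q} (hY : VFDiffAt Y p) (hZ : VFDiffAt Z p) :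
    MDifferentiableAt (𝓡 3) 𝓘(ℝ, ℝ) (fun q => averagedMetric F q (Y q) (Z q)) p ∧
    ∀ v : TangentSpace (𝓡 3) p,
      mfderiv (𝓡 3) 𝓘(ℝ, ℝ) (fun q => averagedMetric F q (Y q) (Z q)) p v =
        averagedMetric F p (nabla Y p v) (Z p) + averagedMetric F p (Y p) (nabla Z p v) := by
  set e := chartAt R3 p
  have he : e ∈ IsManifold.maximalAtlas (𝓡 3) ∞ M := IsManifold.chart_mem_maximalAtlas p
  have hp : p ∈ e.source := mem_chart_source R3 p
  obtain ⟨Q, hQ0, hQd, hQ⟩ := hcompat.exists_local_isometry hsmooth he (e.map_source hp)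
  rw [e.left_inv hp] at hQd
  have hed : HasMFDerivAt (𝓡 3) 𝓘(ℝ, R3) e p (mfderiv (𝓡 3) 𝓘(ℝ, R3) e p) :=
    ((contMDiffAt_of_mem_maximalAtlas he hp).mdifferentiableAt (by simp)).hasMFDerivAt
  -- the coordinates of a vector field as a differentiable function of the coordinates of the point
  have hcoord : ∀ {W : ∀ q : M, TangentSpace (𝓡 3) q}, VFDiffAt W p → ∃ w' : R3 →L[ℝ] R3,
      HasFDerivAt (fun x => coords e (e.symm x) (W (e.symm x))) w' (e p) ∧
      ∀ v, w' (coords e p v) = mvfderiv (𝓡 3) (fun q => coords e q (W q)) p v := by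
    intro W hW
    have h1 := mdifferentiableAt_coords he hp hW
    have h2 : MDifferentiableAt 𝓘(ℝ, R3) 𝓘(ℝ, R3)
        (fun x => coords e (e.symm x) (W (e.symm x))) (e p) :=
      MDifferentiableAt.comp (e p) (g := fun q => coords e q (W q)) (f := e.symm)
        (by rwa [e.left_inv hp])
        ((contMDiffAt_symm_of_mem_maximalAtlas he (e.map_source hp)).mdifferentiableAt (by simp))
    have h3 := h2.differentiableAt.hasFDerivAt
    refine ⟨_, h3, fun v => ?_⟩
    have h4 := (h3.hasMFDerivAt.comp p hed).congr_of_eventuallyEq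
      (f₁ := fun q => coords e q (W q)) (by
        filter_upwards [e.open_source.mem_nhds hp] with q hq
        simp only [Function.comp_apply]
        have : ∀ q', q' = q → coords e q (W q) = coords e q' (W q') := by
          rintro q' rfl
          rfl
        exact this _ (e.left_inv hq))
    simp only [mvfderiv, h4.mfderiv]
    rfl
  obtain ⟨y', hy', hyv⟩ := hcoord hY
  obtain ⟨z', hz', hzv⟩ := hcoord hZ
  set G := gram F e (e p) with hG
  have hpY : ∀ {W : ∀ q : M, TangentSpace (𝓡 3) q},
      coords e (e.symm (e p)) (W (e.symm (e p))) = coords e p (W p) := by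
    intro W
    have : ∀ q', q' = p → coords e q' (W q') = coords e p (W p) := by
      rintro q' rfl
      rfl
    exact this _ (e.left_inv hp)
  obtain ⟨D, hg, hD⟩ : ∃ D : R3 →L[ℝ] ℝ,
      HasFDerivAt (fun x => formOfCLM G (Q x (coords e (e.symm x) (Y (e.symm x))))
        (Q x (coords e (e.symm x) (Z (e.symm x))))) D (e p) ∧
      ∀ u, D u = formOfCLM G (coords e p (Y p))
          (z' u + christoffel nabla e p u (coords e p (Z p))) +
        formOfCLM G (y' u + christoffel nabla e p u (coords e p (Y p))) (coords e p (Z p)) := by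
    refine ⟨_, ((formOfCLM G).hasFDerivAt.comp (e p) (hQd.clm_apply hy')).clm_apply
      (hQd.clm_apply hz'), fun u => ?_⟩
    simp [hQ0, hpY]
  have hf := (hg.hasMFDerivAt.comp p hed).congr_of_eventuallyEq
    (f₁ := fun q => averagedMetric F q (Y q) (Z q)) (by
      filter_upwards [e.open_source.mem_nhds hp, (e.continuousAt hp).preimage_mem_nhds hQ]
        with q hq hAq
      obtain ⟨A, hA, hloc⟩ := hAq
      have h1 : ∀ {W : ∀ q : M, TangentSpace (𝓡 3) q},
          coords e (e.symm (e q)) (W (e.symm (e q))) = coords e q (W q) := by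
        intro W
        have : ∀ q', q' = q → coords e q' (W q') = coords e q (W q) := by
          rintro q' rfl
          rfl
        exact this _ (e.left_inv hq)
      simp only [Function.comp_apply, h1]
      rw [averagedMetric_eq hF he hq, formOfCLM_apply, ← hA, gram, hloc,
        (isMinkowski_localF hF he (e.map_source hp)).formOf_averagedGram_comp A]
      rfl)
  refine ⟨hf.mdifferentiableAt, fun v => ?_⟩
  have hv : mfderiv (𝓡 3) 𝓘(ℝ, ℝ) (fun q => averagedMetric F q (Y q) (Z q)) p v =
      D (coords e p v) := by
    rw [hf.mfderiv]
    rfl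
  rw [hv, hD, averagedMetric_eq hF he hp (nabla Y p v), averagedMetric_eq hF he hp (Y p) (nabla Z p v),
    ← hG]
  have hYc := coords_nabla nabla he hp hY v
  have hZc := coords_nabla nabla he hp hZ v
  rw [← hyv] at hYc
  rw [← hzv] at hZc
  rw [← hYc, ← hZc, formOfCLM_apply, formOfCLM_apply, add_comm]

/-- The Finsler functions of nearby tangent spaces are linearly isometric, so being quadratic is a
locally constant property. -/
theorem IsCompatible.eventually_quadratic_iff [T2Space M]
    (hcompat : IsCompatible F nabla)
    (hsmooth : CovariantDerivative.ContMDiffCovariantDerivative nabla ∞) (p : M) :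
    ∀ᶠ q in nhds p,
      ((∃ B : QuadraticForm ℝ (TangentSpace (𝓡 3) q), ∀ v, F ⟨q, v⟩ ^ 2 = B v) ↔
        ∃ B : QuadraticForm ℝ (TangentSpace (𝓡 3) p), ∀ v, F ⟨p, v⟩ ^ 2 = B v) := by
  set e := chartAt R3 p
  have he : e ∈ IsManifold.maximalAtlas (𝓡 3) ∞ M := IsManifold.chart_mem_maximalAtlas p
  have hp : p ∈ e.source := mem_chart_source R3 p
  obtain ⟨Q, -, -, hQ⟩ := hcompat.exists_local_isometry hsmooth he (e.map_source hp)
  filter_upwards [e.open_source.mem_nhds hp, (e.continuousAt hp).preimage_mem_nhds hQ]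
    with q hq hAq
  obtain ⟨A, -, hloc⟩ := hAq
  set L : TangentSpace (𝓡 3) q ≃L[ℝ] TangentSpace (𝓡 3) p :=
    ((coordsEquiv he hq).trans A).trans (coordsEquiv he hp).symm with hL
  have hFL : ∀ v, F ⟨q, v⟩ = F ⟨p, L v⟩ := by
    intro v
    rw [← localF_apply F he hq, hloc, ← localF_apply F he hp]
    exact congrArg (localF F e (e p)) ((coordsEquiv he hp).apply_symm_apply _).symm
  constructor
  · rintro ⟨B, hB⟩
    refine ⟨B.comp (L.symm.toLinearEquiv : TangentSpace (𝓡 3) p →ₗ[ℝ] TangentSpace (𝓡 3) q),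
      fun v => ?_⟩
    have h := hB (L.symm v)
    rw [hFL, L.apply_symm_apply] at h
    exact h
  · rintro ⟨B, hB⟩
    refine ⟨B.comp (L.toLinearEquiv : TangentSpace (𝓡 3) q →ₗ[ℝ] TangentSpace (𝓡 3) p),
      fun v => ?_⟩
    rw [hFL]
    exact hB (L v)

/-- On a connected manifold with a compatible connection, a Finsler metric that is quadratic on
one tangent space is Riemannian. -/
theorem IsCompatible.isRiemannian_of_quadratic [T2Space M] [ConnectedSpace M]
    (hcompat : IsCompatible F nabla)
    (hsmooth : CovariantDerivative.ContMDiffCovariantDerivative nabla ∞) {p : M}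
    (hp : ∃ B : QuadraticForm ℝ (TangentSpace (𝓡 3) p), ∀ v, F ⟨p, v⟩ ^ 2 = B v) :
    IsRiemannian F := by
  set S : Set M := {p | ∃ B : QuadraticForm ℝ (TangentSpace (𝓡 3) p), ∀ v, F ⟨p, v⟩ ^ 2 = B v}
  have hloc : ∀ p : M, ∀ᶠ q in nhds p, (q ∈ S ↔ p ∈ S) :=
    hcompat.eventually_quadratic_iff hsmooth
  have hclopen : IsClopen S := by
    refine ⟨⟨isOpen_iff_mem_nhds.2 fun p hp => ?_⟩, isOpen_iff_mem_nhds.2 fun p hp => ?_⟩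
    · filter_upwards [hloc p] with q hq using fun h => hp (hq.1 h)
    · filter_upwards [hloc p] with q hq using hq.2 hp
  have huniv := hclopen.eq_univ ⟨p, hp⟩
  intro q
  have hq : q ∈ S := by rw [huniv]; trivial
  exact hq

end Compatible

/-! ### The Levi-Civita connection of the averaged metric -/

section LeviCivita

variable {M : Type*} [TopologicalSpace M] [ChartedSpace R3 M] [IsManifold (𝓡 3) ∞ M]
  {e : OpenPartialHomeomorph M R3} {F : TangentBundle (𝓡 3) M → ℝ} {nabla : LinearConnection M}

theorem averagedMetric_symm (hF : IsFinslerMetric F) (p : M) (v w : TangentSpace (𝓡 3) p) :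
    averagedMetric F p v w = averagedMetric F p w v := by
  have he := IsManifold.chart_mem_maximalAtlas (I := 𝓡 3) (n := ∞) p
  have hp := mem_chart_source R3 p
  rw [averagedMetric_eq hF he hp v w, averagedMetric_eq hF he hp w v]
  exact formOf_symm (gram_posDef hF he ((chartAt R3 p).map_source hp)) _ _

theorem averagedMetric_add_smul_left (hF : IsFinslerMetric F) (p : M) (c : ℝ)
    (u v w : TangentSpace (𝓡 3) p) : averagedMetric F p (u + c • v) w =
      averagedMetric F p u w + c * averagedMetric F p v w := by
  have he := IsManifold.chart_mem_maximalAtlas (I := 𝓡 3) (n := ∞) p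
  have hp := mem_chart_source R3 p
  rw [averagedMetric_eq hF he hp u w, averagedMetric_eq hF he hp v w,
    averagedMetric_eq hF he hp (u + c • v) w]
  simp only [← formOfCLM_apply, ← coordsEquiv_apply he hp, map_add, map_smul, _root_.add_apply,
    _root_.smul_apply, smul_eq_mul]

/-- Subtracting half of its totally antisymmetric torsion turns a metric connection into the
Levi-Civita connection: `∇*_X Y = ∇_X Y - T(X, Y) / 2`. -/
theorem IsCompatible.exists_isLeviCivita [T2Space M] (hF : IsFinslerMetric F)
    (hcompat : IsCompatible F nabla)
    (hsmooth : CovariantDerivative.ContMDiffCovariantDerivative nabla ∞)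
    (htorsion : HasTotallyAntisymmetricTorsion F nabla) :
    ∃ nablaStar : LinearConnection M, IsLeviCivita F nablaStar := by
  have h2 : IsManifold (𝓡 3) 2 M := IsManifold.of_le (n := ∞) (by norm_cast)
  set N : LinearConnection M := nabla.addOneForm fun p => (1 / 2 : ℝ) • nabla.torsion p with hN
  have hNapp : ∀ (Y : ∀ q : M, TangentSpace (𝓡 3) q) (p : M) (v : TangentSpace (𝓡 3) p),
      N Y p v = nabla Y p v + (1 / 2 : ℝ) • nabla.torsion p (Y p) v := fun Y p v => rfl
  refine ⟨N, fun p => ?_, fun p Y Z hY hZ => ?_⟩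
  · ext1 u
    ext1 v
    rw [N.torsion_apply_eq_extend, hNapp, hNapp]
    have h1 := nabla.torsion_apply_eq_extend u v
    have h3 := nabla.torsion_antisymm (x := p) v u
    simp only [FiberBundle.extend_apply_self] at h1 ⊢
    rw [h3]
    simp only [_root_.zero_apply]
    generalize nabla.torsion p u v = T at *
    rw [h1]
    module
  · obtain ⟨hd, hv⟩ := hcompat.averagedMetric_deriv hF hsmooth hY hZ
    refine ⟨hd, fun v => ?_⟩
    have h1 := (htorsion p (Y p) v (Z p)).2
    have h3 := (htorsion p (Z p) v (Y p)).2
    have h4 := (htorsion p (Y p) (Z p) v).1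
    have h5 : averagedMetric F p (N Y p v) (Z p) = averagedMetric F p (nabla Y p v) (Z p) +
        1 / 2 * averagedMetric F p (nabla.torsion p (Y p) v) (Z p) :=
      averagedMetric_add_smul_left hF p _ _ _ _
    have h6 : averagedMetric F p (Y p) (N Z p v) = averagedMetric F p (Y p) (nabla Z p v) +
        1 / 2 * averagedMetric F p (nabla.torsion p (Z p) v) (Y p) := by
      rw [averagedMetric_symm hF p (Y p) (N Z p v), averagedMetric_symm hF p (Y p) (nabla Z p v)]
      exact averagedMetric_add_smul_left hF p _ _ _ _
    refine (hv v).trans (?_ : (_ : ℝ) = _)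
    linarith

/-- The difference of a metric connection with totally antisymmetric torsion and the Levi-Civita
connection is a multiple of the cross product. -/
theorem IsCompatible.exists_sub_eq_smul_cross [T2Space M] (hF : IsFinslerMetric F)
    (hcompat : IsCompatible F nabla)
    (hsmooth : CovariantDerivative.ContMDiffCovariantDerivative nabla ∞)
    (htorsion : HasTotallyAntisymmetricTorsion F nabla) {nablaStar : LinearConnection M}
    (hLC : IsLeviCivita F nablaStar) (he : e ∈ IsManifold.maximalAtlas (𝓡 3) ∞ M) {p : M}
    (hp : p ∈ e.source) :
    ∃ c : ℝ, ∀ u v, christoffel nabla e p u v - christoffel nablaStar e p u v =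
      c • cross (gram F e (e p)) u v := by
  have h2 : IsManifold (𝓡 3) 2 M := IsManifold.of_le (n := ∞) (by norm_cast)
  set G := gram F e (e p) with hGdef
  have hG : G.PosDef := gram_posDef hF he (e.map_source hp)
  set D : R3 →L[ℝ] R3 →L[ℝ] R3 := christoffel nabla e p - christoffel nablaStar e p with hD
  -- the fields with constant coordinates
  set X : R3 → ∀ q : M, TangentSpace (𝓡 3) q := fun y q => ofCoords e q y with hX
  have hXd : ∀ y, VFDiffAt (X y) p := vfDiffAt_ofCoords he hp
  have hXc : ∀ y, coords e p (X y p) = y := coords_ofCoords he hp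
  have hsub : ∀ u v, coords e p (nabla (X v) p (X u p)) -
      coords e p (nablaStar (X v) p (X u p)) = D u v := by
    intro u v
    rw [coords_nabla nabla he hp (hXd v), coords_nabla nablaStar he hp (hXd v), hXc, hXc]
    simp [hD]
  have hmet : ∀ u v w : TangentSpace (𝓡 3) p, averagedMetric F p u w - averagedMetric F p v w =
      formOf G (coords e p u - coords e p v) (coords e p w) := by
    intro u v w
    rw [averagedMetric_eq hF he hp u w, averagedMetric_eq hF he hp v w]
    simp only [← formOfCLM_apply, map_sub, _root_.sub_apply, hGdef]
  have h₁ : ∀ u v w, formOf G (D u v) w = -formOf G (D u w) v := by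
    intro u v w
    have h3 := (hLC.2 p (X v) (X w) (hXd v) (hXd w)).2 (X u p)
    have h4 := (hcompat.averagedMetric_deriv hF hsmooth (hXd v) (hXd w)).2 (X u p)
    have h7 : averagedMetric F p (nablaStar (X v) p (X u p)) (X w p) +
        averagedMetric F p (X v p) (nablaStar (X w) p (X u p)) =
        averagedMetric F p (nabla (X v) p (X u p)) (X w p) +
        averagedMetric F p (X v p) (nabla (X w) p (X u p)) := h3.symm.trans h4
    have h8 := averagedMetric_symm hF p (X v p) (nabla (X w) p (X u p))
    have h9 := averagedMetric_symm hF p (X v p) (nablaStar (X w) p (X u p))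
    have h5 := hmet (nabla (X v) p (X u p)) (nablaStar (X v) p (X u p)) (X w p)
    have h6 := hmet (nabla (X w) p (X u p)) (nablaStar (X w) p (X u p)) (X v p)
    rw [hsub, hXc] at h5 h6
    have key : ∀ {a b c d c' d' x y : ℝ}, b + c = a + d → d = d' → c = c' → a - b = x →
        d' - c' = y → x = -y := by
      intros
      linarith
    exact key h7 h8 h9 h5 h6
  have htors : ∀ u v, coords e p (nabla.torsion p (X u p) (X v p)) = D u v - D v u := by
    intro u v
    have h3 := nabla.torsion_apply (hXd u) (hXd v)
    have h4 := nablaStar.torsion_apply (hXd u) (hXd v)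
    rw [hLC.1 p] at h4
    have h5 : nabla.torsion p (X u p) (X v p) =
        (nabla (X v) p (X u p) - nablaStar (X v) p (X u p)) -
          (nabla (X u) p (X v p) - nablaStar (X u) p (X v p)) := by
      rw [h3, ← sub_zero (nabla (X v) p (X u p) - _ - _)]
      rw [show (0 : TangentSpace (𝓡 3) p) = _ from h4]
      abel
    rw [h5, ← hsub, ← hsub]
    simp only [← coordsEquiv_apply he hp, map_sub]
  have h₂ : ∀ u v w, formOf G (D u v) w - formOf G (D v u) w =
      -(formOf G (D u w) v - formOf G (D w u) v) := by
    intro u v w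
    have h3 := (htorsion p (X u p) (X v p) (X w p)).2
    rw [averagedMetric_eq hF he hp (nabla.torsion p (X u p) (X v p)),
      averagedMetric_eq hF he hp (nabla.torsion p (X u p) (X w p)), htors, htors, hXc, hXc] at h3
    simpa only [← formOfCLM_apply, map_sub, _root_.sub_apply] using h3
  obtain ⟨c, hc⟩ := exists_eq_smul_cross hG D
    (skew_of_skew_skew (d := fun u v w => formOf G (D u v) w) h₁ h₂) h₁
  exact ⟨c, fun u v => by simpa [hD] using hc u v⟩

end LeviCivita

/-! ### The function `f` -/

section Function

variable {M : Type*} [TopologicalSpace M] [ChartedSpace R3 M] [IsManifold (𝓡 3) ∞ M]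
  {e : OpenPartialHomeomorph M R3} {F : TangentBundle (𝓡 3) M → ℝ} {nabla : LinearConnection M}

omit [IsManifold (𝓡 3) ∞ M] in
theorem verticalE_eq (F : TangentBundle (𝓡 3) M → ℝ) (e : OpenPartialHomeomorph M R3)
    (i : Fin 3) (x y : R3) : verticalE F e i x y =
      1 / 2 * fderiv ℝ (energy (localF F e x)) y (cross (gram F e x) (basisVec i) y) := by
  rw [verticalE, map_smul, smul_eq_mul]

theorem continuousAt_verticalE (hF : IsFinslerMetric F)
    (he : e ∈ IsManifold.maximalAtlas (𝓡 3) ∞ M) {x : R3} (hx : x ∈ e.target) (i : Fin 3) {y : R3}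
    (hy : y ≠ 0) : ContinuousAt (verticalE F e i x) y :=
  ((isMinkowski_localF hF he hx).fderiv_energy_smooth hy).continuousAt.clm_apply
    ((continuous_cross _ _).const_smul (1 / 2 : ℝ)).continuousAt

/-- If the rotations of the averaged metric preserve the norm of one tangent space, then the
Finsler metric is Riemannian; so `σ` is positive for a Finsler metric that is not. -/
theorem sigmaFn_pos [T2Space M] [ConnectedSpace M] (hF : IsFinslerMetric F)
    (hnR : ¬ IsRiemannian F) (hcompat : IsCompatible F nabla)
    (hsmooth : CovariantDerivative.ContMDiffCovariantDerivative nabla ∞)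
    (he : e ∈ IsManifold.maximalAtlas (𝓡 3) ∞ M) {p : M} (hp : p ∈ e.source) :
    0 < sigmaFn F e p := by
  have hx := e.map_source hp
  have hφ := isMinkowski_localF hF he hx
  have hnonneg : ∀ i, 0 ≤ indicatrixIntegral (localF F e (e p)) fun y =>
      verticalE F e i (e p) y ^ 2 := fun i => hφ.indicatrixIntegral_nonneg fun y _ => sq_nonneg _
  by_contra hσ
  have hzero : ∀ i, ∀ y ≠ 0, verticalE F e i (e p) (radialMap (localF F e (e p)) y) = 0 := by
    intro i y hy
    by_contra hne
    refine hσ (Finset.sum_pos' (fun j _ => hnonneg j) ⟨i, Finset.mem_univ i, ?_⟩)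
    exact hφ.indicatrixIntegral_pos
      (fun z hz => (continuousAt_verticalE hF he hx i hz).pow 2) (fun z _ => sq_nonneg _) hy
      (by positivity)
  have hrot : ∀ y ≠ 0, ∀ i, fderiv ℝ (energy (localF F e (e p))) y
      (cross (gram F e (e p)) (basisVec i) y) = 0 := by
    intro y hy i
    have h1 := hzero i y hy
    have hpos := inv_pos.2 (hφ.pos hy)
    have hcr : cross (gram F e (e p)) (basisVec i) ((localF F e (e p) y)⁻¹ • y) =
        (localF F e (e p) y)⁻¹ • cross (gram F e (e p)) (basisVec i) y := by
      simp only [cross, WithLp.ofLp_smul, map_smul, Matrix.mulVec_smul, WithLp.toLp_smul]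
      exact smul_comm _ _ _
    rw [verticalE_eq, radialMap, hcr, hφ.fderiv_energy_homog hpos hy, map_smul, smul_eq_mul] at h1
    have h2 := hpos.ne'
    simpa [h2] using h1
  obtain ⟨c, hc⟩ := hφ.exists_sq_eq_of_rotation (gram_posDef hF he hx) hrot
  refine hnR (hcompat.isRiemannian_of_quadratic hsmooth (p := p) ?_)
  set B : LinearMap.BilinForm ℝ R3 :=
    LinearMap.mk₂ ℝ (fun v w => c * formOf (gram F e (e p)) v w)
      (fun _ _ _ => by simp [← formOfCLM_apply, mul_add])
      (fun _ _ _ => by simp [← formOfCLM_apply]; ring)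
      (fun _ _ _ => by simp [← formOfCLM_apply, mul_add])
      (fun _ _ _ => by simp [← formOfCLM_apply]; ring) with hB
  refine ⟨B.toQuadraticMap.comp
    ((coordsEquiv he hp).toLinearEquiv : TangentSpace (𝓡 3) p →ₗ[ℝ] R3), fun v => ?_⟩
  rw [← localF_apply F he hp, hc]
  rfl

/-- As the horizontal lifts of `nabla` annihilate the energy, those of the Levi-Civita connection
differentiate it in the vertical directions `V_i`. -/
theorem horizontalE_eq_mul_verticalE [T2Space M] (hF : IsFinslerMetric F)
    (hcompat : IsCompatible F nabla)
    (hsmooth : CovariantDerivative.ContMDiffCovariantDerivative nabla ∞)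
    {nablaStar : LinearConnection M} (he : e ∈ IsManifold.maximalAtlas (𝓡 3) ∞ M) {p : M}
    (hp : p ∈ e.source) {c : ℝ}
    (hc : ∀ u v, christoffel nabla e p u v - christoffel nablaStar e p u v =
      c • cross (gram F e (e p)) u v) (i : Fin 3) {y : R3} (hy : y ≠ 0) :
    horizontalE F nablaStar e i (e p) y = 2 * c * verticalE F e i (e p) y := by
  have h1 := hcompat.horizontalE_eq_zero hF hsmooth he (e.map_source hp) i hy
  rw [horizontalE_eq, e.left_inv hp] at h1
  have h2 := congrArg (fderiv ℝ (energy (localF F e (e p))) y) (hc (basisVec i) y)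
  rw [map_sub, map_smul, smul_eq_mul] at h2
  rw [horizontalE_eq, e.left_inv hp, verticalE_eq]
  linarith

/-- Since `X_i^{h*} E = 2 c V_i E`, the function `f` is the quotient of `2 c σ` and `σ`. -/
theorem fFn_eq [T2Space M] (hF : IsFinslerMetric F) (hcompat : IsCompatible F nabla)
    (hsmooth : CovariantDerivative.ContMDiffCovariantDerivative nabla ∞)
    {nablaStar : LinearConnection M} (he : e ∈ IsManifold.maximalAtlas (𝓡 3) ∞ M) {p : M}
    (hp : p ∈ e.source) {c : ℝ}
    (hc : ∀ u v, christoffel nabla e p u v - christoffel nablaStar e p u v =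
      c • cross (gram F e (e p)) u v) (hσ : sigmaFn F e p ≠ 0) :
    fFn F nablaStar e p = 2 * c := by
  have hx := e.map_source hp
  have hφ := isMinkowski_localF hF he hx
  have h1 : indicatrixIntegral (localF F e (e p)) (derivVE F nablaStar e (e p)) =
      2 * c * sigmaFn F e p := by
    have hcont : ∀ i ∈ (Finset.univ : Finset (Fin 3)), ∀ y ≠ 0,
        ContinuousAt (fun y => verticalE F e i (e p) y ^ 2) y := fun i _ y hy =>
      (continuousAt_verticalE hF he hx i hy).pow 2
    rw [sigmaFn, ← hφ.indicatrixIntegral_sum _ hcont, ← hφ.indicatrixIntegral_const_mul]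
    refine hφ.indicatrixIntegral_congr fun y hy => ?_
    rw [derivVE, Finset.mul_sum]
    refine Finset.sum_congr rfl fun i _ => ?_
    rw [horizontalE_eq_mul_verticalE hF hcompat hsmooth he hp hc i hy]
    ring
  rw [fFn, h1]
  field_simp

end Function

end Finsler

end

theorem mainTheorem1 {M : Type*} [TopologicalSpace M] [ChartedSpace Finsler.R3 M]
    [IsManifold (𝓡 3) ∞ M] [T2Space M] [ConnectedSpace M]
    (F : TangentBundle (𝓡 3) M → ℝ) (hF : Finsler.IsFinslerMetric F)
    (hnR : ¬ Finsler.IsRiemannian F)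
    (nabla : Finsler.LinearConnection M)
    (hsmooth : CovariantDerivative.ContMDiffCovariantDerivative nabla ∞)
    (hcompat : Finsler.IsCompatible F nabla)
    (htorsion : Finsler.HasTotallyAntisymmetricTorsion F nabla) :
    (∃ nablaStar : Finsler.LinearConnection M, Finsler.IsLeviCivita F nablaStar) ∧
    ∀ nablaStar : Finsler.LinearConnection M, Finsler.IsLeviCivita F nablaStar →
      ∀ e ∈ IsManifold.maximalAtlas (𝓡 3) ∞ M, ∀ p ∈ e.source,
        0 < Finsler.sigmaFn F e p ∧
        ∀ X Y : ∀ q : M, TangentSpace (𝓡 3) q, Finsler.VFDiffAt Y p →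
          nabla Y p (X p) = nablaStar Y p (X p) +
            (Finsler.fFn F nablaStar e p / 2) • Finsler.crossγ F e p (X p) (Y p) := by
  refine ⟨hcompat.exists_isLeviCivita hF hsmooth htorsion, fun nablaStar hLC e he p hp => ?_⟩
  have hσ : 0 < Finsler.sigmaFn F e p := Finsler.sigmaFn_pos hF hnR hcompat hsmooth he hp
  refine ⟨hσ, fun X Y hY => ?_⟩
  obtain ⟨c, hc⟩ := hcompat.exists_sub_eq_smul_cross hF hsmooth htorsion hLC he hp
  have hf : Finsler.fFn F nablaStar e p / 2 = c := by
    rw [Finsler.fFn_eq hF hcompat hsmooth he hp hc hσ.ne', mul_div_cancel_left₀ c two_ne_zero]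
  rw [hf]
  apply (Finsler.coordsEquiv he hp).injective
  rw [map_add, map_smul]
  simp only [Finsler.coordsEquiv_apply]
  rw [Finsler.coords_nabla nabla he hp hY, Finsler.coords_nabla nablaStar he hp hY,
    Finsler.crossγ, Finsler.coords_ofCoords he hp, ← hc]
  abel
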